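/- Let $B_4=\langle\sigma_1,\sigma_2,\sigma_3\mid \sigma_1\sigma_2\sigma_1=\sigma_2\sigma_1\sigma_2,\ \sigma_2\sigma_3\sigma_2=\sigma_3\sigma_2\sigma_3,\ \sigma_1\sigma_3=\sigma_3\sigma_1\rangle$ be the four-strand braid group with its dual (Birman–Ko–Lee) Garside structure. That is, the positive monoid $P$ is generated by $a_{1,2}=\sigma_1$, $a_{2,3}=\sigma_2$, $a_{3,4}=\sigma_3$, $a_{1,3}=\sigma_2^{-1}\sigma_1\sigma_2$, $a_{2,4}=\sigma_3^{-1}\sigma_2\sigma_3$, $a_{1,4}=\sigma_3^{-1}\sigma_2^{-1}\sigma_1\sigma_2\sigma_3$; the Garside element is $\delta=\sigma_1\sigma_2\sigma_3$; $x\preccurlyeq y$ means $x^{-1}y\in P$, and $\wedge$ denotes the greatest common divisor (meet) for $\preccurlyeq$; the simple elements are the $s\in P$ with $s\preccurlyeq\delta$. Write $x^g=g^{-1}xg$, $\tau(x)=x^\delta$, and $\partial(s)=s^{-1}\delta$; a pair $s\,t$ of simple elements is left-weighted if $\partial(s)\wedge t=1$. The weight is the morphism $\lambda:B_4\to\mathbb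 Z$ with $\lambda(a_{p,q})=1$ for all $p<q$. Every $x\in B_4$ has a unique normal form $x=\delta^p x_1\cdots x_r$, where $p$ is the greatest integer with $\delta^p\preccurlyeq x$, the factors $x_i$ are simple, $x_r\neq 1$ if $r\geqslant 1$, and each pair $x_i\,x_{i+1}$ is left-weighted; put $\ell(x)=r$. If $r\geqslant1$, let $\iota(x)=\tau^{-p}(x_1)$ and $\varphi(x)=x_r$, and define cycling $\mathbf c(x)=x^{\iota(x)}$ and cyclic sliding $\mathfrak s(x)=x^{\iota(x)\wedge\partial(\varphi(x))}$; if $r=0$, let $\mathbf c(x)=\mathfrak s(x)=x$. The element $x$ is rigid if $r\geqslant 1$ and the pair $\varphi(x)\,\iota(x)$ is left-weighted. The set of sliding circuits of $x$ is $$SC(x)=\{y\mid y \text{ is conjugate to } x \text{ in } B_4 \text{ and } \mathfrak s^k(y)=y\text{ for some integer } k\geqslant 1\},$$ and the orbit of $x$ is $O_x=\{\tau^k(\mathbf c^l(x))\mid k,l\in\mathbb Z_{\geqslant0}\}$. **Proposition.** Let $x\in B_4$ be rigid, and suppose that among the factors $x_1,\dots,x_r$ of its normal form there is at least one of weight $1$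 and at least one of weight $2$. Then $SC(x)=O_x$; in particular $SC(x)$ is finite and $\#SC(x)\leqslant 4\,\ell(x)$. -/

import Mathlib

namespace BKL4

/-- The relators of Artin's presentation of the braid group on four strands; the generators
`0, 1, 2` stand for `σ₁, σ₂, σ₃`. -/
def artinRelators : Set (FreeGroup (Fin 3)) :=
  {FreeGroup.of 0 * FreeGroup.of 1 * FreeGroup.of 0 *
      (FreeGroup.of 1 * FreeGroup.of 0 * FreeGroup.of 1)⁻¹,
   FreeGroup.of 1 * FreeGroup.of 2 * FreeGroup.of 1 *
      (FreeGroup.of 2 * FreeGroup.of 1 * FreeGroup.of 2)⁻¹,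
   FreeGroup.of 0 * FreeGroup.of 2 * (FreeGroup.of 2 * FreeGroup.of 0)⁻¹}

/-- The braid group on four strands. -/
abbrev B4 : Type := PresentedGroup artinRelators

/-- The Artin generators `σ 0 = σ₁`, `σ 1 = σ₂`, `σ 2 = σ₃`. -/
def σ (i : Fin 3) : B4 := PresentedGroup.of i

/-! The six band generators `a_{p,q}`, `1 ≤ p < q ≤ 4`. -/

def a12 : B4 := σ 0
def a23 : B4 := σ 1
def a34 : B4 := σ 2
def a13 : B4 := (σ 1)⁻¹ * σ 0 * σ 1
def a24 : B4 := (σ 2)⁻¹ * σ 1 * σ 2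
def a14 : B4 := (σ 2)⁻¹ * (σ 1)⁻¹ * σ 0 * σ 1 * σ 2

/-- The set of band generators. -/
def bandGenerators : Set B4 := {a12, a23, a34, a13, a24, a14}

/-- The dual (Birman-Ko-Lee) monoid of positive elements. -/
def positive : Submonoid B4 := Submonoid.closure bandGenerators

/-- The Garside element of the dual structure. -/
def δ : B4 := σ 0 * σ 1 * σ 2

/-- The prefix order: `x ≼ y` if and only if `x⁻¹ y` is positive. -/
def Prefix (x y : B4) : Prop := x⁻¹ * y ∈ positive

/-- `d` is the greatest common divisor `x ∧ y` of `x` and `y` for the prefix order on `B4`. -/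
def IsMeet (d x y : B4) : Prop :=
  Prefix d x ∧ Prefix d y ∧ ∀ c : B4, Prefix c x → Prefix c y → Prefix c d

/-- The greatest common divisor `x ∧ y` as an operation. -/
noncomputable def meet (x y : B4) : B4 := Classical.epsilon fun d => IsMeet d x y

/-- The conjugate `x ^ g = g⁻¹ x g`. -/
def conj (x g : B4) : B4 := g⁻¹ * x * g

/-- The inner automorphism associated to the Garside element. -/
def τ (x : B4) : B4 := conj x δ

/-- Simple elements: the positive divisors of the Garside element. -/
def IsSimple (s : B4) : Prop := s ∈ positive ∧ Prefix s δ

/-- The right complement of `s`. -/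
def compl (s : B4) : B4 := s⁻¹ * δ

/-- The pair `s t` of simple elements is left-weighted: `∂(s) ∧ t = 1`. -/
def LeftWeighted (s t : B4) : Prop := IsMeet 1 (compl s) t

/-- `x = δ ^ p * x₁ ⋯ x_r` is the left normal form of `x`, with `L = [x₁, …, x_r]`. -/
structure IsNormalForm (x : B4) (p : ℤ) (L : List B4) : Prop where
  eq : x = δ ^ p * L.prod
  greatest : IsGreatest {q : ℤ | Prefix (δ ^ q) x} p
  simple : ∀ s ∈ L, IsSimple s
  last_ne_one : ∀ h : L ≠ [], L.getLast h ≠ 1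
  leftWeighted : L.IsChain LeftWeighted

/-- The left normal form of `x`: the exponent of the Garside element and the list of factors. -/
noncomputable def normalForm (x : B4) : ℤ × List B4 :=
  Classical.epsilon fun n => IsNormalForm x n.1 n.2

/-- The infimum of `x`. -/
noncomputable def inf (x : B4) : ℤ := (normalForm x).1

/-- The factors `x₁, …, x_r` of the normal form of `x` (the power of `δ` is not included). -/
noncomputable def factors (x : B4) : List B4 := (normalForm x).2

/-- The canonical length of `x`. -/
noncomputable def len (x : B4) : ℕ := (factors x).length

/-- The initial factor `τ^{-p}(x₁) = δ ^ p x₁ δ ^ (-p)` (used only if `1 ≤ len x`). -/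
noncomputable def initialFactor (x : B4) : B4 :=
  conj ((factors x).headD 1) (δ ^ (-inf x))

/-- The final factor `x_r` (used only if `1 ≤ len x`). -/
noncomputable def finalFactor (x : B4) : B4 := (factors x).getLastD 1

/-- Cycling: conjugation by the initial factor. -/
noncomputable def cycling (x : B4) : B4 :=
  if len x = 0 then x else conj x (initialFactor x)

/-- The preferred prefix `ι(x) ∧ ∂(φ(x))`. -/
noncomputable def preferredPrefix (x : B4) : B4 :=
  meet (initialFactor x) (compl (finalFactor x))

/-- Cyclic sliding: conjugation by the preferred prefix. -/
noncomputable def sliding (x : B4) : B4 :=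
  if len x = 0 then x else conj x (preferredPrefix x)

/-- The set of sliding circuits: the conjugates of `x` that are periodic under cyclic sliding. -/
def SC (x : B4) : Set B4 :=
  {y | (∃ g : B4, y = conj x g) ∧ ∃ k : ℕ, 1 ≤ k ∧ sliding^[k] y = y}

/-- Rigid elements: the canonical length is at least one and the pair `φ(x) ι(x)` is
left-weighted. -/
def IsRigid (x : B4) : Prop :=
  1 ≤ len x ∧ LeftWeighted (finalFactor x) (initialFactor x)

/-- The orbit of `x` under cycling and conjugation by the Garside element. -/
def orbit (x : B4) : Set B4 :=
  {z | ∃ k l : ℕ, z = τ^[k] (cycling^[l] x)}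

/-- The morphism from the braid group to the integers that sends every Artin generator to `1`. -/
def weightHom : B4 →* Multiplicative ℤ :=
  PresentedGroup.toGroup (f := fun _ : Fin 3 => Multiplicative.ofAdd (1 : ℤ)) (by
    intro r hr
    simp only [artinRelators, Set.mem_insert_iff, Set.mem_singleton_iff] at hr
    rcases hr with rfl | rfl | rfl <;> simp)

/-- The weight `λ(x)`. -/
def weight (x : B4) : ℤ := Multiplicative.toAdd (weightHom x)

/-- Every band generator has weight `1`, which characterizes the weight morphism. -/
theorem weight_bandGenerators (a : B4) (ha : a ∈ bandGenerators) : weight a = 1 := by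
  have h : ∀ i, weightHom (σ i) = Multiplicative.ofAdd (1 : ℤ) := fun i =>
    PresentedGroup.toGroup.of _
  simp only [bandGenerators, Set.mem_insert_iff, Set.mem_singleton_iff] at ha
  rcases ha with rfl | rfl | rfl | rfl | rfl | rfl <;>
    simp [weight, a12, a23, a34, a13, a24, a14, h]

end BKL4

/-! Cyclic sliding is governed by a single map S on the group, `slideMap`. It preserves meets and
commutes with right multiplication by δ. The iterates of S at 1 are the conjugators accumulated by
sliding, and an element of positive length is rigid exactly when S fixes 1.

Periodic elements realise the greatest infimum and least supremum of their conjugacy class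
(`SlidingPeriodic.not_le_conj`, `SlidingPeriodic.not_conj_le`), so a rigid x and an element of SC(x)
share the same bounds. Comparing their maps S shows that every element of SC(x) is rigid
(`IsRigid.isRigid_conj`), and that if g conjugates x to a rigid element then so does the simple
element g ∧ δ (`IsRigid.isRigid_conj_inf_delta`). Hence SC(x) is reached from x by simple
conjugators passing only through rigid elements.

The heart is `RigidWord.eq_of_conj`. A simple t taking one rigid element to another gives a chain of
squares s y₁ = x₁ s₁, s₁ y₂ = x₂ s₂, … between their factors, which closes up to a power of τ. A
label of squares, `kind`, cannot increase from one square to the next (`kind_le`), so closing up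
forces it to be constant. Four labels say that t is 1, δ, ι(x) or ∂(φ(x)). Every other label forces
all factors to have weight 1, or all to have weight 2 (`kind_cases`), which the hypothesis excludes.
The four conjugators act as the identity, τ, cycling, and an inverse cycling followed by τ. All stay
in the orbit, since τ has order dividing 4 and the cycling iterated ℓ(x) times acts on x as a power
of τ; this also yields the bound 4 ℓ(x).

The Garside structure itself is derived from Artin's presentation. Simple elements are indexed by
the fourteen noncrossing partitions. A local rule for left multiplication, checked by enumeration,
makes the group act on formal normal forms (`toPerm`); uniqueness of normal forms, a test for
positivity and the lattice property follow. -/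

namespace BKL4

/-! ### The lattice of noncrossing partitions of four points -/

/-- The fourteen noncrossing partitions of `{1, 2, 3, 4}`, which index the simple elements:
`0` is the finest partition, `1, …, 6` stand for `a12, a23, a34, a14, a13, a24`, then come the
triangles `123, 234, 134, 124`, the pairs `12|34` and `23|14`, and `13` is the coarsest one. -/
abbrev NC : Type := Fin 14

namespace NC

/-- The set of atoms below a noncrossing partition, as a bit mask. -/
def mask (s : NC) : ℕ :=
  match s with
  | 0 => 0 | 1 => 1 | 2 => 2 | 3 => 4 | 4 => 8 | 5 => 16 | 6 => 32
  | 7 => 19 | 8 => 38 | 9 => 28 | 10 => 41 | 11 => 5 | 12 => 10 | 13 => 63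

/-- The noncrossing partition with a given set of atoms. -/
def ofMask (m : ℕ) : NC :=
  Fin.ofNat 14 ([0, 1, 2, 4, 8, 16, 32, 19, 38, 28, 41, 5, 10, 63].idxOf m)

/-- The meet. -/
def cap (s t : NC) : NC := ofMask (s.mask &&& t.mask)

/-- The Kreweras complement. -/
def comp (s : NC) : NC :=
  match s with
  | 0 => 13 | 1 => 8 | 2 => 9 | 3 => 10 | 4 => 7 | 5 => 11 | 6 => 12
  | 7 => 3 | 8 => 4 | 9 => 1 | 10 => 2 | 11 => 6 | 12 => 5 | 13 => 0

/-- The inverse of the Kreweras complement. -/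
def compInv (s : NC) : NC :=
  match s with
  | 0 => 13 | 1 => 9 | 2 => 10 | 3 => 7 | 4 => 8 | 5 => 12 | 6 => 11
  | 7 => 4 | 8 => 1 | 9 => 2 | 10 => 3 | 11 => 5 | 12 => 6 | 13 => 0

/-- The join. -/
def cup (s t : NC) : NC := compInv (cap (comp s) (comp t))

/-- The rank, i.e. the weight of the corresponding simple element. -/
def rk (s : NC) : ℕ := if s = 0 then 0 else if s < 7 then 1 else if s < 13 then 2 else 3

/-- The left quotient of `x` by `s`, for `s` below `x`. -/
def quot (s x : NC) : NC := cap (comp s) x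

/-- The rotation. -/
def rot : Equiv.Perm NC where
  toFun s := comp (comp s)
  invFun s := compInv (compInv s)
  left_inv := by decide
  right_inv := by decide

/-- Refinement of partitions. -/
def Below (s t : NC) : Prop := cap s t = s

instance : DecidableRel Below := fun _ _ => inferInstanceAs (Decidable (_ = _))

/-- Left-weighted pairs. -/
def LW (s t : NC) : Prop := cap (comp s) t = 0

instance : DecidableRel LW := fun _ _ => inferInstanceAs (Decidable (_ = _))

/-- The first factor of the left normal form of the product `s x`. -/
def fst (s x : NC) : NC := cup s (cap (comp s) x)

/-- The second factor of the left normal form of the product `s x`. -/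
def snd (s x : NC) : NC := quot (cap (comp s) x) x

/-- Compatibility of the local rule with products, one letter at a time. The two remainders are
again composable, which lets the induction in `push_push` continue along the word. -/
theorem fst_snd_assoc : ∀ s t x : NC, Below t (comp s) →
    fst s (fst t x) = fst (cup s t) x ∧ Below (snd t x) (comp (snd s (fst t x))) ∧
      cup (snd s (fst t x)) (snd t x) = snd (cup s t) x := by
  decide +kernel

/-- The domino rule: one pass from left to right is enough to restore normality. -/
theorem fst_normal : ∀ s x y : NC, LW x y → LW (fst s x) (fst (snd s x) y) := by
  decide +kernel

theorem fst_snd_lw : ∀ s x : NC, LW (fst s x) (snd s x) := by decide +kernel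

theorem fst_ne_zero : ∀ s x : NC, x ≠ 0 → fst s x ≠ 0 := by decide +kernel

theorem fst_of_lw : ∀ s x : NC, LW s x → fst s x = s ∧ snd s x = x := by decide +kernel

theorem fst_of_below : ∀ s x : NC, Below x (comp s) → fst s x = cup s x ∧ snd s x = 0 := by
  decide +kernel

theorem fst_top : ∀ s : NC, fst s 13 = 13 ∧ snd s 13 = rot s := by decide +kernel

theorem lw_top : ∀ s : NC, LW s 13 → s = 13 := by decide +kernel

theorem top_lw : ∀ s : NC, LW 13 s := by decide +kernel

theorem zero_lw : ∀ s : NC, LW 0 s → s = 0 := by decide +kernel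

theorem cup_eq_zero : ∀ s t : NC, cup s t = 0 → s = 0 ∧ t = 0 := by decide +kernel

theorem cup_zero : ∀ s : NC, cup s 0 = s := by decide +kernel

theorem zero_cup : ∀ s : NC, cup 0 s = s := by decide +kernel

theorem below_top : ∀ s : NC, Below s 13 := by decide +kernel

theorem below_self : ∀ s : NC, Below s s := by decide +kernel

theorem zero_below : ∀ s : NC, Below 0 s := by decide +kernel

theorem below_fst : ∀ s x : NC, Below s (fst s x) := by decide +kernel

theorem cap_below_left : ∀ s t : NC, Below (cap s t) s := by decide +kernel

theorem cap_below_right : ∀ s t : NC, Below (cap s t) t := by decide +kernel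

theorem below_cap : ∀ s t u : NC, Below u s → Below u t → Below u (cap s t) := by decide +kernel

theorem below_cup_left : ∀ s t : NC, Below s (cup s t) := by decide +kernel

theorem below_cup_right : ∀ s t : NC, Below t (cup s t) := by decide +kernel

theorem cup_below : ∀ s t u : NC, Below s u → Below t u → Below (cup s t) u := by decide +kernel

theorem quot_spec : ∀ s t : NC, Below s t → Below (quot s t) (comp s) ∧ cup s (quot s t) = t := by
  decide +kernel

theorem comp_spec : ∀ s : NC, cup s (comp s) = 13 := by decide +kernel

theorem compInv_spec : ∀ s : NC, comp (compInv s) = s := by decide +kernel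

theorem rot_lw : ∀ s t : NC, LW (rot s) (rot t) ↔ LW s t := by decide +kernel

theorem rk_rot : ∀ s : NC, rk (rot s) = rk s := by decide +kernel

theorem rot_comp (s : NC) : comp (rot s) = rot (comp s) := rfl

theorem rot_zero : rot 0 = 0 := by decide

theorem rot_top : rot 13 = 13 := by decide

theorem rot_pow_four : rot ^ 4 = 1 := by decide +kernel

theorem zpow_rot_induction {p : NC → NC → Prop} (h : ∀ s t, p (rot s) (rot t) ↔ p s t) (k : ℤ)
    (s t : NC) : p ((rot ^ k) s) ((rot ^ k) t) ↔ p s t := by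
  induction k with
  | zero => simp
  | succ k ih => rw [add_comm, zpow_add, zpow_one, Equiv.Perm.mul_apply, Equiv.Perm.mul_apply, h, ih]
  | pred k ih =>
    rw [← ih, ← h, ← Equiv.Perm.mul_apply, ← Equiv.Perm.mul_apply, ← zpow_one_add]
    simp

theorem zpow_rot_lw (k : ℤ) (s t : NC) : LW ((rot ^ k) s) ((rot ^ k) t) ↔ LW s t :=
  zpow_rot_induction rot_lw k s t

theorem zpow_rot_cup (k : ℤ) (s t : NC) (h : Below t (comp s)) :
    Below ((rot ^ k) t) (comp ((rot ^ k) s)) ∧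
      (rot ^ k) (cup s t) = cup ((rot ^ k) s) ((rot ^ k) t) := by
  have hrot : ∀ s t : NC, (Below (rot t) (comp (rot s)) ↔ Below t (comp s)) := by decide +kernel
  have hcup : ∀ s t : NC, rot (cup s t) = cup (rot s) (rot t) := by decide +kernel
  refine ⟨(zpow_rot_induction (p := fun s t => Below t (comp s)) hrot k s t).2 h, ?_⟩
  have key : ∀ n : ℕ, ∀ s t : NC, (rot ^ n) (cup s t) = cup ((rot ^ n) s) ((rot ^ n) t) := by
    intro n
    induction n with
    | zero => simp
    | succ n ih => intro s t; simp only [pow_succ, Equiv.Perm.mul_apply, hcup, ih]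
  -- The rotation satisfies `rot ^ 4 = 1`, so natural exponents suffice.
  obtain ⟨n, hn⟩ : ∃ n : ℕ, rot ^ k = rot ^ n := by
    refine ⟨(k % 4).toNat, ?_⟩
    rw [← zpow_natCast, Int.toNat_of_nonneg (Int.emod_nonneg _ (by norm_num))]
    conv_lhs => rw [← Int.emod_add_mul_ediv k 4, zpow_add, zpow_mul]
    simp [zpow_ofNat, rot_pow_four]
  rw [hn, key]

theorem zpow_rot_zero (k : ℤ) : (rot ^ k) 0 = 0 :=
  (Equiv.Perm.zpow_apply_eq_self_of_apply_eq_self rot_zero k)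

theorem zpow_rot_top (k : ℤ) : (rot ^ k) 13 = 13 :=
  (Equiv.Perm.zpow_apply_eq_self_of_apply_eq_self rot_top k)

theorem zpow_rot_rk (k : ℤ) (s : NC) : rk ((rot ^ k) s) = rk s := by
  induction k with
  | zero => simp
  | succ k ih => rw [add_comm, zpow_add, zpow_one, Equiv.Perm.mul_apply, rk_rot, ih]
  | pred k ih =>
    rw [← ih, ← rk_rot, ← Equiv.Perm.mul_apply, ← zpow_one_add]
    simp

end NC

open NC

/-! ### Left multiplication of normal words by a simple element -/

/-- Left multiplication of a word of simple elements by a simple element. -/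
def push : NC → List NC → List NC
  | s, [] => if s = 0 then [] else [s]
  | s, x :: L => fst s x :: push (snd s x) L

/-- Normal words: left-weighted and without trivial letters. -/
def Normal (L : List NC) : Prop := L.IsChain LW ∧ 0 ∉ L

theorem Normal.tail {x : NC} {L : List NC} (h : Normal (x :: L)) : Normal L :=
  ⟨h.1.tail, fun h0 => h.2 (List.mem_cons_of_mem _ h0)⟩

theorem push_cons_self {x : NC} {L : List NC} (h : Normal (x :: L)) : push x L = x :: L := by
  induction L generalizing x with
  | nil =>
    have : x ≠ 0 := fun h0 => h.2 (by simp [h0])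
    simp [push, this]
  | cons y L ih =>
    obtain ⟨h1, h2⟩ := fst_of_lw x y (List.isChain_cons_cons.1 h.1).1
    rw [push, h1, h2, ih h.tail]

theorem push_top {L : List NC} (h : Normal L) : push 13 L = 13 :: L :=
  push_cons_self ⟨List.isChain_cons.2 ⟨fun y _ => top_lw y, h.1⟩, List.not_mem_cons_of_ne_of_not_mem (by decide) h.2⟩

theorem zero_notMem_push {s : NC} {L : List NC} (h : 0 ∉ L) : 0 ∉ push s L := by
  induction L generalizing s with
  | nil =>
    rw [push]
    split_ifs with h0
    · simp
    · simpa using Ne.symm h0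
  | cons x L ih =>
    simp only [List.mem_cons, not_or] at h
    simp only [push, List.mem_cons, not_or]
    exact ⟨(fst_ne_zero s x (Ne.symm h.1)).symm, ih h.2⟩

theorem push_normal {s : NC} {L : List NC} (h : Normal L) : Normal (push s L) := by
  refine ⟨?_, zero_notMem_push h.2⟩
  induction L generalizing s with
  | nil => rw [push]; split_ifs <;> simp
  | cons x L ih =>
    rw [push, List.isChain_cons]
    refine ⟨?_, ih h.tail⟩
    cases L with
    | nil =>
      rw [push]
      split_ifs
      · simp
      · simpa using fst_snd_lw s x
    | cons y L =>
      simpa [push] using fst_normal s x y (List.isChain_cons_cons.1 h.1).1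

theorem push_push {s t : NC} (hst : Below t (comp s)) (L : List NC) :
    push s (push t L) = push (cup s t) L := by
  induction L generalizing s t with
  | nil =>
    by_cases ht : t = 0
    · simp [push, ht, cup_zero]
    · have hc : cup s t ≠ 0 := fun h => ht (cup_eq_zero s t h).2
      obtain ⟨h1, h2⟩ := fst_of_below s t hst
      simp [push, ht, hc, h1, h2]
  | cons x L ih =>
    obtain ⟨h1, h2, h3⟩ := fst_snd_assoc s t x hst
    rw [push, push, push, ih h2, h1, h3]

/-! ### The action of the braid group on formal normal forms -/

/-- Move the initial letters `13` of a word into the exponent. -/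
def strip : ℤ → List NC → ℤ × List NC
  | p, [] => (p, [])
  | p, x :: L => if x = 13 then strip (p + 1) L else (p, x :: L)

/-- The normal forms. -/
abbrev NF : Type := {n : ℤ × List NC // Normal n.2 ∧ n.2.head? ≠ some 13}

theorem strip_spec (p : ℤ) {L : List NC} (h : Normal L) :
    Normal (strip p L).2 ∧ (strip p L).2.head? ≠ some 13 := by
  induction L generalizing p with
  | nil => simpa [strip] using h
  | cons x L ih =>
    rw [strip]
    split_ifs with hx
    · exact ih _ h.tail
    · simpa [hx] using h

theorem le_strip (p : ℤ) (L : List NC) : p ≤ (strip p L).1 := by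
  induction L generalizing p with
  | nil => simp [strip]
  | cons x L ih =>
    rw [strip]
    split_ifs with hx
    · exact (by omega : p ≤ p + 1).trans (ih _)
    · rfl

theorem strip_of_head {p : ℤ} {L : List NC} (h : L.head? ≠ some 13) : strip p L = (p, L) := by
  cases L with
  | nil => rfl
  | cons x L => rw [strip, if_neg (by simpa using h)]

/-- Left multiplication of a normal form by a simple element. -/
def act (s : NC) (n : NF) : NF :=
  ⟨strip n.1.1 (push ((rot ^ n.1.1) s) n.1.2), strip_spec _ (push_normal n.2.1)⟩

/-- Pushing a letter past δ rotates it, and raising the exponent by one rotates it in the same way;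
hence extracting the leading δ's before or after the push makes no difference. -/
theorem strip_push_strip (s : NC) (p : ℤ) {K : List NC} (hK : Normal K) :
    strip (strip p K).1 (push ((rot ^ (strip p K).1) s) (strip p K).2) =
      strip p (push ((rot ^ p) s) K) := by
  induction K generalizing p with
  | nil => simp [strip]
  | cons x K ih =>
    by_cases hx : x = 13
    · subst hx
      rw [strip, if_pos rfl, ih _ hK.tail, push, (fst_top _).1, (fst_top _).2, strip, if_pos rfl,
        ← Equiv.Perm.mul_apply, ← zpow_one_add, add_comm]
    · rw [strip, if_neg hx]

theorem act_act {s t : NC} (h : Below t (comp s)) (n : NF) :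
    act s (act t n) = act (cup s t) n := by
  obtain ⟨⟨p, L⟩, hL⟩ := n
  obtain ⟨h1, h2⟩ := zpow_rot_cup p s t h
  apply Subtype.ext
  change strip (strip p (push ((rot ^ p) t) L)).1 _ = strip p _
  rw [h2, ← push_push h1]
  exact strip_push_strip s p (push_normal hL.1)

theorem act_top (n : NF) : (act 13 n).1 = (n.1.1 + 1, n.1.2) := by
  obtain ⟨⟨p, L⟩, hL⟩ := n
  change strip p (push ((rot ^ p) 13) L) = _
  rw [zpow_rot_top, push_top hL.1, strip, if_pos rfl, strip_of_head hL.2]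

/-- The top letter only shifts the exponent, hence acts bijectively. Each letter is both a left and
a right factor of the top letter, which gives surjectivity and injectivity. -/
theorem act_bijective (s : NC) : Function.Bijective (act s) := by
  have htop : Function.Bijective (act 13) := by
    refine ⟨fun m n h => ?_, fun n => ⟨⟨(n.1.1 - 1, n.1.2), n.2⟩, ?_⟩⟩
    · have h' := congrArg Subtype.val h
      rw [act_top, act_top] at h'
      apply Subtype.ext
      simp only [Prod.mk.injEq, add_left_inj] at h'
      exact Prod.ext h'.1 h'.2
    · apply Subtype.ext
      rw [act_top]
      simp
  have h : ∀ s, act s ∘ act (comp s) = act 13 := fun s => funext fun n => by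
    rw [Function.comp_apply, act_act (by rw [Below]; revert s; decide +kernel), comp_spec]
  refine ⟨?_, ?_⟩
  · have h1 := h (compInv s)
    rw [compInv_spec] at h1
    exact Function.Injective.of_comp (h1 ▸ htop.1)
  · exact Function.Surjective.of_comp ((h s) ▸ htop.2)

/-- Left multiplication by a simple element as a permutation of the normal forms. -/
noncomputable def actPerm (s : NC) : Equiv.Perm NF := Equiv.ofBijective _ (act_bijective s)

theorem actPerm_mul {s t : NC} (h : Below t (comp s)) :
    actPerm s * actPerm t = actPerm (cup s t) :=
  Equiv.ext fun n => act_act h n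

/-- The action of the braid group on the normal forms. -/
noncomputable def toPerm : B4 →* Equiv.Perm NF :=
  PresentedGroup.toGroup (f := ![actPerm 1, actPerm 2, actPerm 3]) (by
    -- A triangle factors in three ways into two of its edges; combining these dual relations gives
    -- Artin's relations.
    have h12 : actPerm 1 * actPerm 2 = actPerm 7 := actPerm_mul (s := 1) (t := 2) (by decide)
    have h25 : actPerm 2 * actPerm 5 = actPerm 7 := actPerm_mul (s := 2) (t := 5) (by decide)
    have h51 : actPerm 5 * actPerm 1 = actPerm 7 := actPerm_mul (s := 5) (t := 1) (by decide)
    have h23 : actPerm 2 * actPerm 3 = actPerm 8 := actPerm_mul (s := 2) (t := 3) (by decide)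
    have h36 : actPerm 3 * actPerm 6 = actPerm 8 := actPerm_mul (s := 3) (t := 6) (by decide)
    have h62 : actPerm 6 * actPerm 2 = actPerm 8 := actPerm_mul (s := 6) (t := 2) (by decide)
    have h13 : actPerm 1 * actPerm 3 = actPerm 11 := actPerm_mul (s := 1) (t := 3) (by decide)
    have h31 : actPerm 3 * actPerm 1 = actPerm 11 := actPerm_mul (s := 3) (t := 1) (by decide)
    intro r hr
    simp only [artinRelators, Set.mem_insert_iff, Set.mem_singleton_iff] at hr
    rcases hr with rfl | rfl | rfl <;>
      simp only [map_mul, map_inv, FreeGroup.lift_apply_of, Matrix.cons_val, mul_inv_eq_one]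
    · have h : actPerm 2 * actPerm 7 = actPerm 7 * actPerm 1 := by
        conv_lhs => rw [← h51, ← mul_assoc, h25]
      rw [h12, mul_assoc, h12, h]
    · have h : actPerm 3 * actPerm 8 = actPerm 8 * actPerm 2 := by
        conv_lhs => rw [← h62, ← mul_assoc, h36]
      rw [h23, mul_assoc, h23, h]
    · rw [h13, h31])

/-! ### The simple elements of the braid group -/

theorem braid01 : σ 0 * σ 1 * σ 0 = σ 1 * σ 0 * σ 1 :=
  PresentedGroup.mk_eq_mk_of_mul_inv_mem (rels := artinRelators) (by simp [artinRelators])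

theorem braid12 : σ 1 * σ 2 * σ 1 = σ 2 * σ 1 * σ 2 :=
  PresentedGroup.mk_eq_mk_of_mul_inv_mem (rels := artinRelators) (by simp [artinRelators])

theorem commute02 : σ 0 * σ 2 = σ 2 * σ 0 :=
  PresentedGroup.mk_eq_mk_of_mul_inv_mem (rels := artinRelators) (by simp [artinRelators])

theorem a13_eq : a13 = a12 * a23 * a12⁻¹ := by
  rw [a13, a12, a23, mul_assoc, inv_mul_eq_iff_eq_mul, ← mul_assoc, ← mul_assoc, ← braid01]
  group

theorem a24_eq : a24 = a23 * a34 * a23⁻¹ := by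
  rw [a24, a23, a34, mul_assoc, inv_mul_eq_iff_eq_mul, ← mul_assoc, ← mul_assoc, ← braid12]
  group

theorem a23_mul_a13 : a23 * a13 = a12 * a23 := by simp [a23, a13, a12, mul_assoc]

theorem a13_mul_a12 : a13 * a12 = a12 * a23 := by simp [a13_eq]

theorem a34_mul_a24 : a34 * a24 = a23 * a34 := by simp [a34, a24, a23, mul_assoc]

theorem a24_mul_a23 : a24 * a23 = a23 * a34 := by simp [a24_eq]

theorem a34_mul_a12 : a34 * a12 = a12 * a34 := commute02.symm

theorem a34_mul_a14 : a34 * a14 = a13 * a34 := by simp [a34, a14, a13, mul_assoc]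

theorem a14_eq : a14 = a12 * a24 * a12⁻¹ := by
  have h : a14 = a34⁻¹ * a13 * a34 := by simp [a14, a34, a13, mul_assoc]
  have h' : a34⁻¹ * a12 = a12 * a34⁻¹ := by
    rw [inv_mul_eq_iff_eq_mul, ← mul_assoc, a34_mul_a12, mul_assoc, mul_inv_cancel, mul_one]
  have h'' : a12⁻¹ * a34 = a34 * a12⁻¹ := by
    rw [inv_mul_eq_iff_eq_mul, ← mul_assoc, ← a34_mul_a12, mul_assoc, mul_inv_cancel, mul_one]
  have h3 : a24 = a34⁻¹ * a23 * a34 := rfl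
  rw [h, a13_eq, h3]
  simp only [mul_assoc, h'']
  simp only [← mul_assoc, h']

theorem a14_mul_a12 : a14 * a12 = a12 * a24 := by simp [a14_eq]

theorem a24_mul_a14 : a24 * a14 = a12 * a24 := by
  have h : a34⁻¹ * a12 = a12 * a34⁻¹ := by
    rw [inv_mul_eq_iff_eq_mul, ← mul_assoc, a34_mul_a12, mul_assoc, mul_inv_cancel, mul_one]
  have h2 : a24 * a14 = (a34⁻¹ * a12) * a23 * a34 := by
    simp [a14, a34, a12, a23, a24, mul_assoc]
  rw [h2, h]
  simp [a34, a12, a23, a24, mul_assoc]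

theorem a14_mul_a13 : a14 * a13 = a13 * a34 := by
  rw [a14_eq, a13_eq]
  have h : a12⁻¹ * a34 = a34 * a12⁻¹ := by
    rw [inv_mul_eq_iff_eq_mul, ← mul_assoc, ← a34_mul_a12, mul_assoc, mul_inv_cancel, mul_one]
  calc a12 * a24 * a12⁻¹ * (a12 * a23 * a12⁻¹) = a12 * (a24 * a23) * a12⁻¹ := by group
    _ = a12 * a23 * (a34 * a12⁻¹) := by rw [a24_mul_a23]; group
    _ = a12 * a23 * a12⁻¹ * a34 := by rw [← h]; group

theorem a14_mul_a23 : a14 * a23 = a23 * a14 := by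
  have h : a12 * a23 * a12 = a23 * a12 * a23 := braid01
  have h' : a12⁻¹ * a34 = a34 * a12⁻¹ := by
    rw [inv_mul_eq_iff_eq_mul, ← mul_assoc, ← a34_mul_a12, mul_assoc, mul_inv_cancel, mul_one]
  rw [a14_eq, a24_eq]
  have h2 : a23⁻¹ * a12⁻¹ * a23 = a12 * a23⁻¹ * a12⁻¹ := by
    rw [eq_mul_inv_iff_mul_eq, mul_assoc, mul_assoc, inv_mul_eq_iff_eq_mul,
      inv_mul_eq_iff_eq_mul, ← mul_assoc, ← mul_assoc, h]
    group
  calc a12 * (a23 * a34 * a23⁻¹) * a12⁻¹ * a23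
      = a12 * a23 * a34 * (a23⁻¹ * a12⁻¹ * a23) := by group
    _ = a12 * a23 * (a34 * a12) * a23⁻¹ * a12⁻¹ := by rw [h2]; group
    _ = (a12 * a23 * a12) * a34 * a23⁻¹ * a12⁻¹ := by rw [a34_mul_a12]; group
    _ = a23 * (a12 * (a23 * a34 * a23⁻¹) * a12⁻¹) := by rw [h]; group

/-- The simple element of a noncrossing partition. -/
def val (s : NC) : B4 :=
  match s with
  | 0 => 1 | 1 => a12 | 2 => a23 | 3 => a34 | 4 => a14 | 5 => a13 | 6 => a24
  | 7 => a12 * a23 | 8 => a23 * a34 | 9 => a13 * a34 | 10 => a12 * a24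
  | 11 => a12 * a34 | 12 => a23 * a14 | 13 => δ

theorem val_zero : val 0 = 1 := rfl

theorem val_top : val 13 = δ := rfl

theorem val_cup {s t : NC} (h : Below t (comp s)) : val (cup s t) = val s * val t := by
  -- The list holds all products of two nontrivial simple elements that are again simple. Each is
  -- then rewritten to the factorization chosen in `val`.
  have key : ∀ s t : NC, Below t (comp s) → s = 0 ∨ t = 0 ∨ (s, t, cup s t) ∈
      ([(1, 2, 7), (1, 3, 11), (1, 6, 10), (1, 8, 13), (2, 3, 8), (2, 4, 12), (2, 5, 7),
        (2, 9, 13), (3, 1, 11), (3, 4, 9), (3, 6, 8), (3, 10, 13), (4, 1, 10),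
        (4, 2, 12), (4, 5, 9), (4, 7, 13), (5, 1, 7), (5, 3, 9), (5, 11, 13), (6, 2, 8),
        (6, 4, 10), (6, 12, 13), (7, 3, 13), (8, 4, 13), (9, 1, 13), (10, 2, 13),
        (11, 6, 13), (12, 5, 13)] : List (NC × NC × NC)) := by
    decide +kernel
  have re : ∀ {a b c d : B4}, a * b = c * d → ∀ x, a * (b * x) = c * (d * x) := by
    intro a b c d h x
    rw [← mul_assoc, h, mul_assoc]
  have hd : δ = a12 * (a23 * a34) := mul_assoc _ _ _
  rcases key s t h with rfl | rfl | h
  · rw [zero_cup, val_zero, one_mul]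
  · rw [cup_zero, val_zero, mul_one]
  · simp only [List.mem_cons, Prod.mk.injEq, List.not_mem_nil, or_false] at h
    rcases h with h | h | h | h | h | h | h | h | h | h | h | h | h | h | h | h | h | h | h | h |
      h | h | h | h | h | h | h | h <;> obtain ⟨rfl, rfl, h⟩ := h <;>
      rw [h] <;>
      simp only [val, hd, mul_assoc, a23_mul_a13, a13_mul_a12, a34_mul_a24, a24_mul_a23,
        a34_mul_a12, a34_mul_a14, a14_mul_a12, a24_mul_a14, a14_mul_a13, a14_mul_a23,
        re a23_mul_a13, re a13_mul_a12, re a24_mul_a23,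
        re a34_mul_a12, re a14_mul_a12]

theorem val_mul_val_comp (s : NC) : val s * val (comp s) = δ := by
  rw [← val_cup (by rw [Below]; revert s; decide +kernel), comp_spec, val_top]

theorem val_comp (s : NC) : val (comp s) = compl (val s) := by
  rw [compl, eq_inv_mul_iff_mul_eq, val_mul_val_comp]

theorem val_mul_delta (s : NC) : val s * δ = δ * val (rot s) := by
  rw [← val_mul_val_comp s, mul_assoc (val s), show rot s = comp (comp s) from rfl,
    val_mul_val_comp (comp s), val_mul_val_comp s]

theorem val_mul_delta_zpow (s : NC) (p : ℤ) : val s * δ ^ p = δ ^ p * val ((rot ^ p) s) := by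
  induction p with
  | zero => simp
  | succ p ih =>
    rw [zpow_add_one, ← mul_assoc, ih, mul_assoc, val_mul_delta, ← Equiv.Perm.mul_apply,
      ← zpow_one_add, add_comm 1, ← mul_assoc, ← zpow_add_one]
  | pred p ih =>
    have h : ∀ u : NC, val u * δ⁻¹ = δ⁻¹ * val (rot⁻¹ u) := fun u => by
      have := val_mul_delta (rot⁻¹ u)
      rw [show rot (rot⁻¹ u) = u from rot.apply_symm_apply u] at this
      rw [mul_inv_eq_iff_eq_mul, mul_assoc, eq_inv_mul_iff_mul_eq, this]
    rw [zpow_sub_one, ← mul_assoc, ih, mul_assoc, h, ← Equiv.Perm.mul_apply, ← zpow_neg_one rot,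
      ← zpow_add, add_comm (-1), ← sub_eq_add_neg, ← mul_assoc]

theorem val_fst_mul_val_snd (s x : NC) : val (fst s x) * val (snd s x) = val s * val x := by
  obtain ⟨h1, h2⟩ := quot_spec _ _ (cap_below_right (comp s) x)
  rw [fst, snd, val_cup (cap_below_left _ _), mul_assoc, ← val_cup h1, h2]

/-- The product of a word of simple elements. -/
def word (L : List NC) : B4 := (L.map val).prod

theorem word_nil : word [] = 1 := rfl

theorem word_cons (x : NC) (L : List NC) : word (x :: L) = val x * word L := by
  simp [word]

theorem word_append (K L : List NC) : word (K ++ L) = word K * word L := by simp [word]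

theorem word_mul_delta_zpow (L : List NC) (p : ℤ) :
    word L * δ ^ p = δ ^ p * word (L.map (rot ^ p)) := by
  induction L with
  | nil => simp [word]
  | cons x L ih =>
    rw [word_cons, mul_assoc, ih, ← mul_assoc, val_mul_delta_zpow, List.map_cons, word_cons,
      mul_assoc]

theorem word_push (s : NC) (L : List NC) : word (push s L) = val s * word L := by
  induction L generalizing s with
  | nil =>
    rw [push]
    split_ifs with h
    · simp [word, h, val_zero]
    · simp [word]
  | cons x L ih =>
    rw [push, word_cons, ih, word_cons, ← mul_assoc, val_fst_mul_val_snd, mul_assoc]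

/-! ### Evaluation and uniqueness of normal forms -/

/-- The braid of a normal form. -/
def eval (n : ℤ × List NC) : B4 := δ ^ n.1 * word n.2

theorem eval_strip (p : ℤ) (L : List NC) : eval (strip p L) = δ ^ p * word L := by
  induction L generalizing p with
  | nil => simp [strip, eval]
  | cons x L ih =>
    rw [strip]
    split_ifs with h
    · rw [ih, word_cons, h, val_top, zpow_add_one, mul_assoc]
    · rfl

theorem eval_act (s : NC) (n : NF) : eval (act s n).1 = val s * eval n.1 := by
  rw [act, eval_strip, word_push, eval, ← mul_assoc, ← val_mul_delta_zpow, mul_assoc]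

theorem toPerm_val (s : NC) : toPerm (val s) = actPerm s := by
  have hσ : ∀ i : Fin 3, toPerm (σ i) = ![actPerm 1, actPerm 2, actPerm 3] i := fun i =>
    PresentedGroup.toGroup.of _
  have h1 : toPerm a12 = actPerm 1 := hσ 0
  have h2 : toPerm a23 = actPerm 2 := hσ 1
  have h3 : toPerm a34 = actPerm 3 := hσ 2
  have hm : ∀ s t : NC, Below t (comp s) → actPerm (cup s t) = actPerm s * actPerm t :=
    fun s t h => (actPerm_mul h).symm
  have h5 : toPerm a13 = actPerm 5 := by
    apply mul_left_cancel (a := actPerm 2)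
    rw [← h2, ← map_mul, a23_mul_a13, map_mul, h1, h2]
    exact (hm 1 2 (by decide)).symm.trans (hm 2 5 (by decide))
  have h6 : toPerm a24 = actPerm 6 := by
    apply mul_left_cancel (a := actPerm 3)
    rw [← h3, ← map_mul, a34_mul_a24, map_mul, h2, h3]
    exact (hm 2 3 (by decide)).symm.trans (hm 3 6 (by decide))
  have h4 : toPerm a14 = actPerm 4 := by
    apply mul_left_cancel (a := actPerm 3)
    rw [← h3, ← map_mul, a34_mul_a14, map_mul, h5, h3]
    exact (hm 5 3 (by decide)).symm.trans (hm 3 4 (by decide))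
  have h0 : toPerm (val 0) = actPerm 0 := by
    apply mul_left_cancel (a := actPerm 0)
    rw [val_zero, map_one, mul_one]
    exact hm 0 0 (by decide)
  have h8 : toPerm (val 8) = actPerm 8 := by
    rw [val, map_mul, h2, h3]; exact (hm 2 3 (by decide)).symm
  match s with
  | 0 => exact h0
  | 1 => exact h1
  | 2 => exact h2
  | 3 => exact h3
  | 4 => exact h4
  | 5 => exact h5
  | 6 => exact h6
  | 7 => rw [val, map_mul, h1, h2]; exact (hm 1 2 (by decide)).symm
  | 8 => exact h8
  | 9 => rw [val, map_mul, h5, h3]; exact (hm 5 3 (by decide)).symm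
  | 10 => rw [val, map_mul, h1, h6]; exact (hm 1 6 (by decide)).symm
  | 11 => rw [val, map_mul, h1, h3]; exact (hm 1 3 (by decide)).symm
  | 12 => rw [val, map_mul, h2, h4]; exact (hm 2 4 (by decide)).symm
  | 13 =>
    rw [val_top, ← val_mul_val_comp 1, map_mul]
    exact (congrArg₂ (· * ·) h1 h8).trans (hm 1 8 (by decide)).symm

theorem toPerm_val_apply (s : NC) (n : NF) : toPerm (val s) n = act s n := by
  rw [toPerm_val]; rfl

/-- The braids whose action is left multiplication form a subgroup, and it contains the generators.
-/
theorem eval_toPerm (g : B4) (n : NF) : eval (toPerm g n).1 = g * eval n.1 := by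
  let H : Subgroup B4 :=
    { carrier := {g | ∀ n : NF, eval (toPerm g n).1 = g * eval n.1}
      one_mem' := fun n => by simp
      mul_mem' := fun {a b} ha hb n => by
        rw [map_mul, Equiv.Perm.mul_apply, ha, hb, mul_assoc]
      inv_mem' := fun {a} ha n => by
        rw [eq_inv_mul_iff_mul_eq, ← ha, ← Equiv.Perm.mul_apply, ← map_mul]
        simp }
  have h : ∀ i : Fin 3, σ i ∈ H := by
    have key : ∀ s : NC, val s ∈ H := fun s n => by rw [toPerm_val_apply, eval_act]
    intro i
    fin_cases i
    exacts [key 1, key 2, key 3]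
  exact PresentedGroup.generated_by artinRelators H h g n

/-- The normal form of a braid. -/
noncomputable def nf (g : B4) : NF := toPerm g ⟨(0, []), by simp [Normal]⟩

theorem eval_nf (g : B4) : eval (nf g).1 = g := by
  rw [nf, eval_toPerm]
  simp [eval, word]

theorem toPerm_delta_zpow (p : ℤ) (n : NF) : (toPerm (δ ^ p) n).1 = (n.1.1 + p, n.1.2) := by
  have h1 : ∀ n : NF, (toPerm δ n).1 = (n.1.1 + 1, n.1.2) := fun n => by
    rw [← val_top, toPerm_val_apply, act_top]
  have h2 : ∀ n : NF, (toPerm δ⁻¹ n).1 = (n.1.1 - 1, n.1.2) := fun n => by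
    have h := h1 (toPerm δ⁻¹ n)
    rw [← Equiv.Perm.mul_apply, ← map_mul] at h
    simp only [mul_inv_cancel, map_one, Equiv.Perm.coe_one, id_eq] at h
    rw [h]
    simp
  induction p with
  | zero => simp
  | succ p ih =>
    rw [zpow_add_one, (Commute.zpow_self δ (p : ℤ)).eq, map_mul, Equiv.Perm.mul_apply, h1, ih]
    simp [add_assoc]
  | pred p ih =>
    rw [zpow_sub_one, ((Commute.zpow_self δ (-p : ℤ)).inv_right).eq, map_mul,
      Equiv.Perm.mul_apply, h2, ih]
    simp [add_sub_assoc]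

theorem nf_eval (n : NF) : nf (eval n.1) = n := by
  obtain ⟨⟨p, L⟩, hL, hh⟩ := n
  apply Subtype.ext
  rw [eval, nf, map_mul, Equiv.Perm.mul_apply, toPerm_delta_zpow]
  -- A normal word acting on the trivial form is rebuilt letter by letter from the right, because
  -- prepending a left-weighted letter changes nothing else.
  have key : (toPerm (word L) ⟨(0, []), by simp [Normal]⟩).1 = (0, L) := by
    induction L with
    | nil => simp [word]
    | cons x M ih =>
      have hx : x ≠ 13 := by simpa using hh
      have hM : M.head? ≠ some 13 := by
        intro h
        obtain ⟨N, rfl⟩ := List.head?_eq_some_iff.1 h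
        exact hx (lw_top x (List.isChain_cons_cons.1 hL.1).1)
      rw [word_cons, map_mul, Equiv.Perm.mul_apply, toPerm_val_apply]
      change strip _ (push ((rot ^ _) x) _) = _
      rw [ih hL.tail hM]
      simp only [zpow_zero, Equiv.Perm.coe_one, id_eq]
      rw [push_cons_self hL, strip_of_head hh]
  rw [key]
  simp

theorem eval_injective {m n : NF} (h : eval m.1 = eval n.1) : m = n := by
  rw [← nf_eval m, h, nf_eval]

/-! ### Weight and the positive monoid -/

theorem weight_mul (x y : B4) : weight (x * y) = weight x + weight y := by
  simp [weight]

theorem weight_one : weight 1 = 0 := by simp [weight]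

theorem weight_inv (x : B4) : weight x⁻¹ = -weight x := by simp [weight]

theorem val_mem_positive (s : NC) : val s ∈ positive := by
  have h : ∀ a ∈ bandGenerators, a ∈ positive := fun a ha => Submonoid.subset_closure ha
  have h1 : a12 ∈ positive := h _ (by simp [bandGenerators])
  have h2 : a23 ∈ positive := h _ (by simp [bandGenerators])
  have h3 : a34 ∈ positive := h _ (by simp [bandGenerators])
  have h4 : a14 ∈ positive := h _ (by simp [bandGenerators])
  have h5 : a13 ∈ positive := h _ (by simp [bandGenerators])
  have h6 : a24 ∈ positive := h _ (by simp [bandGenerators])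
  match s with
  | 0 => exact one_mem _
  | 1 => exact h1
  | 2 => exact h2
  | 3 => exact h3
  | 4 => exact h4
  | 5 => exact h5
  | 6 => exact h6
  | 7 => exact mul_mem h1 h2
  | 8 => exact mul_mem h2 h3
  | 9 => exact mul_mem h5 h3
  | 10 => exact mul_mem h1 h6
  | 11 => exact mul_mem h1 h3
  | 12 => exact mul_mem h2 h4
  | 13 => exact mul_mem (mul_mem h1 h2) h3

theorem word_mem_positive (L : List NC) : word L ∈ positive := by
  refine Submonoid.list_prod_mem _ fun x hx => ?_
  obtain ⟨s, -, rfl⟩ := List.mem_map.1 hx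
  exact val_mem_positive s

theorem exists_val_of_mem_bandGenerators {a : B4} (ha : a ∈ bandGenerators) :
    ∃ s : NC, val s = a := by
  simp only [bandGenerators, Set.mem_insert_iff, Set.mem_singleton_iff] at ha
  rcases ha with rfl | rfl | rfl | rfl | rfl | rfl
  exacts [⟨1, rfl⟩, ⟨2, rfl⟩, ⟨3, rfl⟩, ⟨5, rfl⟩, ⟨6, rfl⟩, ⟨4, rfl⟩]

theorem exists_word_of_mem_positive {g : B4} (hg : g ∈ positive) : ∃ L, word L = g := by
  induction hg using Submonoid.closure_induction with
  | mem a ha =>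
    obtain ⟨s, rfl⟩ := exists_val_of_mem_bandGenerators ha
    exact ⟨[s], by simp [word]⟩
  | one => exact ⟨[], rfl⟩
  | mul a b _ _ iha ihb =>
    obtain ⟨K, rfl⟩ := iha
    obtain ⟨L, rfl⟩ := ihb
    exact ⟨K ++ L, word_append K L⟩

theorem le_toPerm_of_mem_positive {g : B4} (hg : g ∈ positive) (n : NF) :
    n.1.1 ≤ (toPerm g n).1.1 := by
  induction hg using Submonoid.closure_induction generalizing n with
  | mem a ha =>
    obtain ⟨s, rfl⟩ := exists_val_of_mem_bandGenerators ha
    rw [toPerm_val_apply]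
    exact le_strip _ _
  | one => simp
  | mul a b _ _ iha ihb =>
    rw [map_mul, Equiv.Perm.mul_apply]
    exact (ihb n).trans (iha _)

/-- Multiplying by a simple element never lowers the exponent of δ, so positive braids keep it
nonnegative. -/
theorem mem_positive_iff (g : B4) : g ∈ positive ↔ 0 ≤ (nf g).1.1 := by
  refine ⟨fun h => le_toPerm_of_mem_positive h _, fun h => ?_⟩
  rw [← eval_nf g, eval]
  refine mul_mem ?_ (word_mem_positive _)
  obtain ⟨k, hk⟩ := Int.eq_ofNat_of_zero_le h
  rw [hk, zpow_natCast]
  exact pow_mem (val_mem_positive 13) k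

/-- This yields antisymmetry of the prefix order and makes weight strictly monotone, the source of
all termination arguments below. -/
theorem positive_eq_one_or {g : B4} (hg : g ∈ positive) : g = 1 ∨ 1 ≤ weight g := by
  induction hg using Submonoid.closure_induction with
  | mem a ha => exact Or.inr (weight_bandGenerators a ha).ge
  | one => exact Or.inl rfl
  | mul a b _ _ iha ihb =>
    rw [weight_mul]
    rcases iha with rfl | h1 <;> rcases ihb with rfl | h2
    · simp
    · right; simpa [weight_one] using h2
    · right; simpa [weight_one] using h1
    · right; omega

/-! ### The prefix order is a lattice order -/

instance : PartialOrder B4 where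
  le := Prefix
  le_refl x := by simp [Prefix, one_mem]
  le_trans x y z hxy hyz := by
    have := mul_mem (s := positive) hxy hyz
    rwa [mul_assoc, mul_inv_cancel_left] at this
  le_antisymm x y hxy hyx := by
    have h := weight_mul (x⁻¹ * y) (y⁻¹ * x)
    rw [mul_assoc, mul_inv_cancel_left, inv_mul_cancel, weight_one] at h
    rcases positive_eq_one_or hxy with h1 | h1
    · exact inv_mul_eq_one.1 h1
    rcases positive_eq_one_or hyx with h2 | h2
    · exact (inv_mul_eq_one.1 h2).symm
    · omega

theorem le_iff_prefix {x y : B4} : x ≤ y ↔ Prefix x y := Iff.rfl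

instance : MulLeftMono B4 where
  elim x y z h := by
    have h' : y⁻¹ * z ∈ positive := h
    change (x * y)⁻¹ * (x * z) ∈ positive
    simpa [mul_assoc] using h'

theorem one_le_iff {g : B4} : 1 ≤ g ↔ g ∈ positive := by
  rw [le_iff_prefix, Prefix, inv_one, one_mul]

theorem one_le_word (L : List NC) : 1 ≤ word L := one_le_iff.2 (word_mem_positive L)

theorem one_le_val (s : NC) : 1 ≤ val s := one_le_iff.2 (val_mem_positive s)

theorem exists_word_of_le {x y : B4} (h : x ≤ y) : ∃ L, y = x * word L := by
  obtain ⟨L, hL⟩ := exists_word_of_mem_positive h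
  exact ⟨L, by rw [hL]; simp⟩

/-- The order is left-invariant by construction; right invariance holds for powers of δ because they
normalise the positive monoid. -/
theorem mul_delta_zpow_le {x y : B4} (h : x ≤ y) (k : ℤ) : x * δ ^ k ≤ y * δ ^ k := by
  obtain ⟨L, rfl⟩ := exists_word_of_le h
  rw [mul_assoc x, word_mul_delta_zpow, ← mul_assoc]
  exact le_mul_of_one_le_right' (one_le_word _)

theorem mul_delta_zpow_le_iff {x y : B4} (k : ℤ) : x * δ ^ k ≤ y * δ ^ k ↔ x ≤ y :=
  ⟨fun h => by simpa using mul_delta_zpow_le h (-k), fun h => mul_delta_zpow_le h k⟩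

theorem mul_delta_le_iff {x y : B4} : x * δ ≤ y * δ ↔ x ≤ y := by
  simpa using mul_delta_zpow_le_iff (x := x) (y := y) 1

theorem weight_le_of_le {x y : B4} (h : x ≤ y) : weight x ≤ weight y := by
  have h2 := weight_mul x (x⁻¹ * y)
  rw [mul_inv_cancel_left] at h2
  rcases positive_eq_one_or h with h1 | h1
  · rw [h1, weight_one] at h2; omega
  · omega

theorem eq_of_le_of_weight_le {x y : B4} (h : x ≤ y) (hw : weight y ≤ weight x) : x = y := by
  have h2 := weight_mul x (x⁻¹ * y)
  rw [mul_inv_cancel_left] at h2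
  rcases positive_eq_one_or h with h1 | h1
  · exact inv_mul_eq_one.1 h1
  · omega

theorem weight_lt_of_lt {x y : B4} (h : x < y) : weight x < weight y := by
  by_contra hw
  exact h.ne (eq_of_le_of_weight_le h.le (not_lt.1 hw))

theorem weight_delta : weight δ = 3 := by
  have h : ∀ i, weight (σ i) = 1 := fun i => by
    rw [weight, weightHom, σ, PresentedGroup.toGroup.of]; rfl
  rw [δ, weight_mul, weight_mul, h, h, h]; rfl

theorem weight_delta_zpow (k : ℤ) : weight (δ ^ k) = 3 * k := by
  have h : weight (δ ^ k) = k * weight δ := by simp [weight]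
  rw [h, weight_delta, mul_comm]

theorem weight_val (s : NC) : weight (val s) = rk s := by
  have h : ∀ a ∈ bandGenerators, weight a = 1 := weight_bandGenerators
  simp only [bandGenerators, Set.mem_insert_iff, Set.mem_singleton_iff, forall_eq_or_imp,
    forall_eq] at h
  obtain ⟨h1, h2, h3, h4, h5, h6⟩ := h
  fin_cases s <;> simp [val, weight_mul, weight_one, weight_delta, h1, h2, h3, h4, h5, h6, rk]

theorem one_le_delta : 1 ≤ δ := one_le_val 13

theorem delta_zpow_le {a b : ℤ} (h : a ≤ b) : δ ^ a ≤ δ ^ b := by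
  obtain ⟨k, rfl⟩ := Int.le.dest h
  rw [zpow_add, zpow_natCast]
  exact le_mul_of_one_le_right' (one_le_pow_of_one_le' one_le_delta k)

theorem val_le_delta (s : NC) : val s ≤ δ := by
  rw [← val_mul_val_comp s]
  exact le_mul_of_one_le_right' (one_le_val _)

theorem word_le_delta_zpow (L : List NC) : word L ≤ δ ^ (L.length : ℤ) := by
  induction L with
  | nil => simp [word]
  | cons x L ih =>
    rw [word_cons, List.length_cons, Nat.cast_add, Nat.cast_one, zpow_add_one]
    calc val x * word L ≤ val x * δ ^ (L.length : ℤ) := mul_le_mul_right ih _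
      _ = δ ^ (L.length : ℤ) * val ((rot ^ (L.length : ℤ)) x) := val_mul_delta_zpow _ _
      _ ≤ δ ^ (L.length : ℤ) * δ := mul_le_mul_right (val_le_delta _) _

theorem delta_zpow_le_eval (p : ℤ) (L : List NC) : δ ^ p ≤ eval (p, L) :=
  le_mul_of_one_le_right' (one_le_word L)

theorem eval_le_delta_zpow (p : ℤ) (L : List NC) : eval (p, L) ≤ δ ^ (p + L.length) := by
  rw [zpow_add]
  exact mul_le_mul_right (word_le_delta_zpow L) _

theorem exists_delta_bounds (x : B4) : ∃ m : ℕ, δ ^ (-m : ℤ) ≤ x ∧ x ≤ δ ^ (m : ℤ) := by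
  obtain ⟨p, L, h⟩ : ∃ p L, eval (p, L) = x := ⟨_, _, eval_nf x⟩
  refine ⟨p.natAbs + L.length, ?_, ?_⟩ <;> rw [← h]
  · exact (delta_zpow_le (by omega)).trans (delta_zpow_le_eval p L)
  · exact (eval_le_delta_zpow p L).trans (delta_zpow_le (by omega))

/-- The greatest simple prefix of a positive braid. -/
noncomputable def head (g : B4) : NC :=
  if 0 < (nf g).1.1 then 13 else (nf g).1.2.headD 0

theorem val_head_le {g : B4} (hg : 1 ≤ g) : val (head g) ≤ g := by
  have h0 : 0 ≤ (nf g).1.1 := (mem_positive_iff g).1 (one_le_iff.1 hg)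
  have he := eval_nf g
  rcases h : (nf g).1 with ⟨p, L⟩
  rw [h] at he h0
  rw [head, h]
  simp only at h0 ⊢
  split_ifs with hp
  · rw [val_top, ← he]
    refine le_trans ?_ (delta_zpow_le_eval p L)
    simpa using delta_zpow_le (a := 1) (b := p) (by omega)
  · obtain rfl : p = 0 := by omega
    rw [← he]
    cases L with
    | nil => simp [eval, word, val_zero]
    | cons x L =>
      simp only [eval, zpow_zero, one_mul, List.headD_cons, word_cons]
      exact le_mul_of_one_le_right' (one_le_word L)

/-- Writing g as s times a positive braid, the local rule shows that the first letter of the result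
absorbs s. Consequently the simple prefixes of g are closed under joins (`val_cup_le`), from which
all joins are built. -/
theorem below_head {s : NC} {g : B4} (hg : val s ≤ g) : Below s (head g) := by
  obtain ⟨K, rfl⟩ := exists_word_of_le hg
  have h0 : 0 ≤ (nf (word K)).1.1 := (mem_positive_iff _).1 (word_mem_positive K)
  have hn : nf (val s * word K) = act s (nf (word K)) := by
    rw [nf, map_mul, Equiv.Perm.mul_apply, toPerm_val_apply, nf]
  rw [head, hn]
  rcases h : nf (word K) with ⟨⟨p, L⟩, hL⟩
  rw [h] at h0
  change Below s (if 0 < (strip p (push ((rot ^ p) s) L)).1 then 13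
    else (strip p (push ((rot ^ p) s) L)).2.headD 0)
  by_cases hp : 0 < (strip p (push ((rot ^ p) s) L)).1
  · rw [if_pos hp]
    exact below_top s
  · rw [if_neg hp]
    have hp0 : p = 0 := by
      change 0 ≤ p at h0
      have := le_strip p (push ((rot ^ p) s) L)
      omega
    subst hp0
    simp only [zpow_zero, Equiv.Perm.coe_one, id_eq] at hp ⊢
    rcases hK : push s L with _ | ⟨x, M⟩
    · have : s = 0 := by
        cases L with
        | nil =>
          rw [push] at hK
          split_ifs at hK with hs
          exact hs
        | cons y L => simp [push] at hK
      rw [this]; exact zero_below _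
    · rw [hK, strip] at hp
      rw [strip]
      split_ifs at hp ⊢ with hx
      · have := le_strip (0 + 1) M
        omega
      · simp only [List.headD_cons]
        cases L with
        | nil =>
          rw [push] at hK
          split_ifs at hK with hs
          simp only [List.cons.injEq] at hK
          rw [← hK.1]; exact below_self s
        | cons y L =>
          rw [push, List.cons.injEq] at hK
          rw [← hK.1]
          exact below_fst s y

theorem val_le_val_of_below {s t : NC} (h : Below s t) : val s ≤ val t := by
  obtain ⟨h1, h2⟩ := quot_spec s t h
  rw [← h2, val_cup h1]
  exact le_mul_of_one_le_right' (one_le_val _)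

theorem val_le_iff {s : NC} {g : B4} (hg : 1 ≤ g) : val s ≤ g ↔ Below s (head g) :=
  ⟨below_head, fun h => (val_le_val_of_below h).trans (val_head_le hg)⟩

theorem val_cup_le {s t : NC} {g : B4} (hs : val s ≤ g) (ht : val t ≤ g) : val (cup s t) ≤ g :=
  (val_le_iff ((one_le_val s).trans hs)).2 (cup_below _ _ _ (below_head hs) (below_head ht))

theorem nf_val (s : NC) :
    (nf (val s)).1 = if s = 0 then (0, []) else if s = 13 then (1, []) else (0, [s]) := by
  split_ifs with h0 h13
  · rw [h0, val_zero, nf]; simp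
  · have h := congrArg Subtype.val (nf_eval ⟨(1, []), by simp [Normal]⟩)
    simpa [eval, word, val_top, h13] using h
  · have h0' : ¬ 0 = s := fun h => h0 h.symm
    have h := congrArg Subtype.val (nf_eval ⟨(0, [s]), by simp [Normal, h0', h13]⟩)
    simpa [eval, word] using h

theorem val_injective : Function.Injective val := by
  intro s t h
  have hn := nf_val s
  rw [h, nf_val] at hn
  split_ifs at hn <;> simp_all

theorem val_le_val_iff {s t : NC} : val s ≤ val t ↔ Below s t := by
  refine ⟨fun h => ?_, val_le_val_of_below⟩
  have h1 : val (cup s t) = val t :=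
    le_antisymm (val_cup_le h le_rfl) (val_le_val_of_below (below_cup_right s t))
  have h2 := below_cup_left s t
  rwa [val_injective h1] at h2

theorem exists_val_of_le_delta {g : B4} (h1 : 1 ≤ g) (h2 : g ≤ δ) : ∃ s, val s = g := by
  obtain ⟨L, rfl⟩ := exists_word_of_mem_positive (one_le_iff.1 h1)
  clear h1
  induction L with
  | nil => exact ⟨0, rfl⟩
  | cons x L ih =>
    rw [word_cons, ← val_mul_val_comp x, mul_le_mul_iff_left] at h2
    obtain ⟨t, ht⟩ := ih (h2.trans (val_le_delta _))
    rw [← ht] at h2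
    exact ⟨cup x t, by rw [val_cup (val_le_val_iff.1 h2), word_cons, ht]⟩

/-- Joining s with the first letter x leaves a simple complement after x, which plays the role of s
for the rest of the word. -/
theorem exists_isLUB_val_word (s : NC) (L : List NC) :
    ∃ t : NC, IsLUB {val s, word L} (word L * val t) := by
  induction L generalizing s with
  | nil =>
    refine ⟨s, ?_⟩
    rw [word_nil, one_mul]
    refine ⟨?_, fun u hu => hu (by simp)⟩
    rintro y (rfl | rfl)
    exacts [le_rfl, one_le_val s]
  | cons x L ih =>
    obtain ⟨h1, h2⟩ := quot_spec _ _ (below_cup_right s x)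
    have hc : val (cup s x) = val x * val (quot x (cup s x)) := by rw [← val_cup h1, h2]
    obtain ⟨t, ht⟩ := ih (quot x (cup s x))
    refine ⟨t, ?_, fun u hu => ?_⟩
    · rintro y (rfl | rfl)
      · refine (val_le_val_of_below (below_cup_left s x)).trans ?_
        rw [hc, word_cons, mul_assoc]
        exact mul_le_mul_right (ht.1 (by simp)) _
      · exact le_mul_of_one_le_right' (one_le_val t)
    · have hs : val s ≤ u := hu (by simp)
      have hx : val x * word L ≤ u := by rw [← word_cons]; exact hu (by simp)
      have hx' : val x ≤ u := (le_mul_of_one_le_right' (one_le_word L)).trans hx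
      rw [word_cons, mul_assoc, ← le_inv_mul_iff_mul_le]
      apply ht.2
      rintro y (rfl | rfl)
      · rw [le_inv_mul_iff_mul_le, ← hc]
        exact val_cup_le hs hx'
      · rwa [le_inv_mul_iff_mul_le]

theorem exists_isLUB_word (K L : List NC) : ∃ j, IsLUB {word K, word L} j := by
  induction K generalizing L with
  | nil =>
    refine ⟨word L, ?_, fun u hu => hu (by simp)⟩
    rintro y (rfl | rfl)
    exacts [one_le_word L, le_rfl]
  | cons x K ih =>
    obtain ⟨t, ht⟩ := exists_isLUB_val_word x L
    obtain ⟨M, hM⟩ := exists_word_of_le (ht.1 (Set.mem_insert _ _))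
    obtain ⟨j, hj⟩ := ih M
    refine ⟨val x * j, ?_, fun u hu => ?_⟩
    · rintro y (rfl | rfl)
      · rw [word_cons]; exact mul_le_mul_right (hj.1 (by simp)) _
      · exact (le_mul_of_one_le_right' (one_le_val t)).trans
          (hM.trans_le (mul_le_mul_right (hj.1 (by simp)) _))
    · have hK : val x * word K ≤ u := by rw [← word_cons]; exact hu (by simp)
      have hx : val x ≤ u := (le_mul_of_one_le_right' (one_le_word K)).trans hK
      rw [← le_inv_mul_iff_mul_le]
      apply hj.2
      rintro y (rfl | rfl)
      · rwa [le_inv_mul_iff_mul_le]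
      · rw [le_inv_mul_iff_mul_le, ← hM]
        apply ht.2
        rintro y (rfl | rfl)
        exacts [hx, hu (by simp)]

theorem exists_isLUB (x y : B4) : ∃ j, IsLUB {x, y} j := by
  obtain ⟨m, hm, -⟩ := exists_delta_bounds x
  obtain ⟨n, hn, -⟩ := exists_delta_bounds y
  -- A common lower bound, a power of δ, is divided out to reduce to positive braids.
  obtain ⟨K, hK⟩ := exists_word_of_le
    ((delta_zpow_le (a := -(m + n : ℕ)) (b := -m) (by push_cast; omega)).trans hm)
  obtain ⟨L, hL⟩ := exists_word_of_le
    ((delta_zpow_le (a := -(m + n : ℕ)) (b := -n) (by push_cast; omega)).trans hn)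
  obtain ⟨j, hj⟩ := exists_isLUB_word K L
  set d := δ ^ (-(m + n : ℕ) : ℤ)
  refine ⟨d * j, ?_, fun u hu => ?_⟩
  · rintro z (rfl | rfl)
    · rw [hK]; exact mul_le_mul_right (hj.1 (by simp)) _
    · rw [hL]; exact mul_le_mul_right (hj.1 (by simp)) _
  · rw [← le_inv_mul_iff_mul_le]
    apply hj.2
    rintro z (rfl | rfl)
    · rw [le_inv_mul_iff_mul_le, ← hK]; exact hu (by simp)
    · rw [le_inv_mul_iff_mul_le, ← hL]; exact hu (by simp)

/-- Weight is bounded on common prefixes. One of maximal weight is greatest, since its join with any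
other is again a common prefix. -/
theorem exists_isGLB (x y : B4) : ∃ d, IsGLB {x, y} d := by
  obtain ⟨m, hm, -⟩ := exists_delta_bounds x
  obtain ⟨n, hn, -⟩ := exists_delta_bounds y
  have h0 : ∃ k : ℤ, ∃ c, c ≤ x ∧ c ≤ y ∧ weight c = k :=
    ⟨_, δ ^ (-(m + n : ℕ) : ℤ), (delta_zpow_le (by push_cast; omega)).trans hm,
      (delta_zpow_le (by push_cast; omega)).trans hn, rfl⟩
  obtain ⟨k, ⟨c, hcx, hcy, hck⟩, hk⟩ := Int.exists_greatest_of_bdd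
    ⟨weight x, by rintro z ⟨c, hc, -, rfl⟩; exact weight_le_of_le hc⟩ h0
  refine ⟨c, ?_, fun d hd => ?_⟩
  · rintro z (rfl | rfl)
    exacts [hcx, hcy]
  · obtain ⟨j, hj⟩ := exists_isLUB c d
    have hjx : j ≤ x := hj.2 (by rintro z (rfl | rfl); exacts [hcx, hd (by simp)])
    have hjy : j ≤ y := hj.2 (by rintro z (rfl | rfl); exacts [hcy, hd (by simp)])
    have hcj : c ≤ j := hj.1 (by simp)
    rw [eq_of_le_of_weight_le hcj (hck ▸ hk _ ⟨j, hjx, hjy, rfl⟩)]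
    exact hj.1 (by simp)

noncomputable instance : SemilatticeInf B4 where
  inf x y := (exists_isGLB x y).choose
  inf_le_left x y := (exists_isGLB x y).choose_spec.1 (by simp)
  inf_le_right x y := (exists_isGLB x y).choose_spec.1 (by simp)
  le_inf c x y hx hy := (exists_isGLB x y).choose_spec.2 (by rintro z (rfl | rfl); exacts [hx, hy])

theorem isMeet_iff {d x y : B4} : IsMeet d x y ↔ d = x ⊓ y := by
  constructor
  · rintro ⟨h1, h2, h3⟩
    exact le_antisymm (le_inf h1 h2) (h3 _ (inf_le_left : x ⊓ y ≤ x) (inf_le_right : x ⊓ y ≤ y))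
  · rintro rfl
    exact ⟨(inf_le_left : x ⊓ y ≤ x), (inf_le_right : x ⊓ y ≤ y), fun c hx hy => le_inf (α := B4) hx hy⟩

theorem meet_eq (x y : B4) : meet x y = x ⊓ y :=
  isMeet_iff.1 (Classical.epsilon_spec (p := fun d => IsMeet d x y) ⟨_, isMeet_iff.2 rfl⟩)

theorem mul_inf_eq (g x y : B4) : g * (x ⊓ y) = g * x ⊓ g * y := by
  apply le_antisymm
  · exact le_inf (mul_le_mul_right inf_le_left g) (mul_le_mul_right inf_le_right g)
  · rw [← inv_mul_le_iff_le_mul]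
    exact le_inf (inv_mul_le_iff_le_mul.2 inf_le_left) (inv_mul_le_iff_le_mul.2 inf_le_right)

theorem inf_mul_delta_zpow (x y : B4) (k : ℤ) : (x ⊓ y) * δ ^ k = x * δ ^ k ⊓ y * δ ^ k := by
  apply le_antisymm
  · exact le_inf (mul_delta_zpow_le inf_le_left k) (mul_delta_zpow_le inf_le_right k)
  · rw [← mul_delta_zpow_le_iff (-k), mul_assoc, ← zpow_add, add_neg_cancel, zpow_zero, mul_one]
    refine le_inf ?_ ?_
    · simpa using mul_delta_zpow_le (inf_le_left (a := x * δ ^ k) (b := y * δ ^ k)) (-k)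
    · simpa using mul_delta_zpow_le (inf_le_right (a := x * δ ^ k) (b := y * δ ^ k)) (-k)

theorem inf_mul_delta (x y : B4) : (x ⊓ y) * δ = x * δ ⊓ y * δ := by
  simpa using inf_mul_delta_zpow x y 1

theorem val_cap (s t : NC) : val (cap s t) = val s ⊓ val t := by
  apply le_antisymm
  · exact le_inf (val_le_val_of_below (cap_below_left s t))
      (val_le_val_of_below (cap_below_right s t))
  · obtain ⟨u, hu⟩ := exists_val_of_le_delta (le_inf (one_le_val s) (one_le_val t))
      (inf_le_left.trans (val_le_delta s))
    rw [← hu]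
    exact val_le_val_of_below (below_cap _ _ _ (val_le_val_iff.1 (hu.trans_le inf_le_left))
      (val_le_val_iff.1 (hu.trans_le inf_le_right)))

theorem leftWeighted_val_iff {s t : NC} : LeftWeighted (val s) (val t) ↔ LW s t := by
  rw [LeftWeighted, isMeet_iff, ← val_comp, ← val_cap, LW, ← val_zero, val_injective.eq_iff,
    eq_comm]

theorem isSimple_iff {g : B4} : IsSimple g ↔ ∃ s, val s = g := by
  constructor
  · rintro ⟨h1, h2⟩
    exact exists_val_of_le_delta (one_le_iff.2 h1) h2
  · rintro ⟨s, rfl⟩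
    exact ⟨val_mem_positive s, val_le_delta s⟩

/-! ### Normal forms, initial and final factors -/

theorem delta_zpow_le_eval_iff (p q : ℤ) {L : List NC} (h : Normal L ∧ L.head? ≠ some 13) :
    δ ^ q ≤ eval (p, L) ↔ q ≤ p := by
  refine ⟨fun hq => ?_, fun hq => (delta_zpow_le hq).trans (delta_zpow_le_eval p L)⟩
  have h1 : (δ ^ q)⁻¹ * eval (p, L) = eval (p - q, L) := by
    rw [eval, eval, ← mul_assoc, ← zpow_neg, ← zpow_add, neg_add_eq_sub]
  have h2 := (mem_positive_iff _).1 (show (δ ^ q)⁻¹ * eval (p, L) ∈ positive from hq)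
  rw [h1, nf_eval ⟨(p - q, L), h⟩] at h2
  simpa using h2

/-- In a left-weighted word a trivial letter is followed only by trivial letters, so forbidding a
trivial last factor forbids them all. -/
theorem zero_notMem_of_getLast {L : List NC} (h : L.IsChain LW) (hl : ∀ hL : L ≠ [],
    L.getLast hL ≠ 0) : 0 ∉ L := by
  induction L with
  | nil => simp
  | cons x L ih =>
    rw [List.mem_cons, not_or]
    have hL : 0 ∉ L := ih h.tail fun hL => by simpa [List.getLast_cons hL] using hl (by simp)
    refine ⟨?_, hL⟩
    rintro rfl
    cases L with
    | nil => exact hl (by simp) rfl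
    | cons y L => exact hL (by simp [zero_lw y (List.isChain_cons_cons.1 h).1])

theorem isNormalForm_eval {p : ℤ} {L : List NC} (h : Normal L ∧ L.head? ≠ some 13) :
    IsNormalForm (eval (p, L)) p (L.map val) where
  eq := rfl
  greatest := ⟨delta_zpow_le_eval p L, fun q hq => (delta_zpow_le_eval_iff p q h).1 hq⟩
  simple s hs := by
    obtain ⟨t, -, rfl⟩ := List.mem_map.1 hs
    exact isSimple_iff.2 ⟨t, rfl⟩
  last_ne_one hL h1 := by
    have hL' : L ≠ [] := by simpa using hL
    rw [List.getLast_map, ← val_zero, val_injective.eq_iff] at h1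
    exact h.1.2 (h1 ▸ List.getLast_mem hL')
  leftWeighted := by
    rw [List.isChain_map]
    exact h.1.1.imp fun _ _ => leftWeighted_val_iff.2

theorem IsNormalForm.unique {x : B4} {p q : ℤ} {L : List NC} {M : List B4}
    (h : Normal L ∧ L.head? ≠ some 13) (hx : x = eval (p, L)) (hM : IsNormalForm x q M) :
    q = p ∧ M = L.map val := by
  obtain ⟨K, rfl⟩ : M ∈ Set.range (List.map val) := by
    rw [Set.range_list_map]
    exact fun s hs => isSimple_iff.1 (hM.simple s hs)
  have hK : Normal K := by
    have hc : K.IsChain LW :=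
      ((List.isChain_map val).1 hM.leftWeighted).imp fun _ _ => leftWeighted_val_iff.1
    refine ⟨hc, zero_notMem_of_getLast hc fun hK h0 => ?_⟩
    refine hM.last_ne_one (by simpa using hK) ?_
    rw [List.getLast_map, h0, val_zero]
  have hh : K.head? ≠ some 13 := by
    intro h13
    obtain ⟨N, rfl⟩ := List.head?_eq_some_iff.1 h13
    have : q + 1 ≤ q := hM.greatest.2 (by
      change δ ^ (q + 1) ≤ x
      rw [hM.eq, List.map_cons, List.prod_cons, val_top, ← mul_assoc, ← zpow_add_one]
      exact le_mul_of_one_le_right' (one_le_word N))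
    omega
  have he := eval_injective (m := ⟨(p, L), h⟩) (n := ⟨(q, K), hK, hh⟩) (hx.symm.trans hM.eq)
  simp only [Subtype.mk.injEq, Prod.mk.injEq] at he
  exact ⟨he.1.symm, by rw [he.2]⟩

theorem normalForm_eval {p : ℤ} {L : List NC} (h : Normal L ∧ L.head? ≠ some 13) :
    normalForm (eval (p, L)) = (p, L.map val) := by
  have h1 : IsNormalForm (eval (p, L)) (normalForm (eval (p, L))).1
      (normalForm (eval (p, L))).2 :=
    Classical.epsilon_spec (p := fun n : ℤ × List B4 => IsNormalForm (eval (p, L)) n.1 n.2)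
      ⟨(p, L.map val), isNormalForm_eval h⟩
  obtain ⟨h2, h3⟩ := h1.unique h rfl
  exact Prod.ext h2 h3

theorem inf_eval {p : ℤ} {L : List NC} (h : Normal L ∧ L.head? ≠ some 13) :
    inf (eval (p, L)) = p := by
  rw [inf, normalForm_eval h]

theorem factors_eval {p : ℤ} {L : List NC} (h : Normal L ∧ L.head? ≠ some 13) :
    factors (eval (p, L)) = L.map val := by
  rw [factors, normalForm_eval h]

theorem len_eval {p : ℤ} {L : List NC} (h : Normal L ∧ L.head? ≠ some 13) :
    len (eval (p, L)) = L.length := by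
  rw [len, factors_eval h, List.length_map]

theorem exists_eval (x : B4) : ∃ p L, (Normal L ∧ L.head? ≠ some 13) ∧ x = eval (p, L) :=
  ⟨_, _, (nf x).2, (eval_nf x).symm⟩

theorem conj_val_delta_zpow (s : NC) (p : ℤ) : conj (val s) (δ ^ p) = val ((rot ^ p) s) := by
  rw [conj, mul_assoc, val_mul_delta_zpow, inv_mul_cancel_left]

theorem initialFactor_eval {p : ℤ} {s : NC} {L : List NC}
    (h : Normal (s :: L) ∧ (s :: L).head? ≠ some 13) :
    initialFactor (eval (p, s :: L)) = val ((rot ^ (-p)) s) := by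
  rw [initialFactor, factors_eval h, inf_eval h, List.map_cons, List.headD_cons,
    conj_val_delta_zpow]

theorem finalFactor_eval {p : ℤ} {s : NC} {L : List NC}
    (h : Normal (L ++ [s]) ∧ (L ++ [s]).head? ≠ some 13) :
    finalFactor (eval (p, L ++ [s])) = val s := by
  rw [finalFactor, factors_eval h]
  simp [List.getLastD_eq_getLast?]

/-- Left-weightedness is local: the complement of s is simple, so it meets the word only through the
word's greatest simple prefix, its first letter. -/
theorem word_inf_comp {s : NC} {L : List NC} (h : (s :: L).IsChain LW) :
    word L ⊓ val (comp s) = 1 := by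
  induction L generalizing s with
  | nil => exact inf_eq_left.2 (one_le_val _)
  | cons x L ih =>
    have hx : word (x :: L) ⊓ δ = val x := by
      rw [word_cons, ← val_mul_val_comp x, ← mul_inf_eq, ih h.tail, mul_one]
    rw [← inf_eq_right.2 (val_le_delta (comp s)), ← inf_assoc, hx, ← val_cap, ← val_zero]
    congr 1
    have h1 := (List.isChain_cons_cons.1 h).1
    rw [LW] at h1
    rw [← h1, cap, cap, Nat.land_comm]

theorem word_inf_delta {s : NC} {L : List NC} (h : (s :: L).IsChain LW) :
    word (s :: L) ⊓ δ = val s := by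
  rw [word_cons, ← val_mul_val_comp s, ← mul_inf_eq, word_inf_comp h, mul_one]

/-- The mirror image of `word_inf_delta`: passing to the inverse lets the last letter be read off by
a meet. -/
theorem word_inv_inf_delta {s : NC} {L : List NC} (h : (L ++ [s]).IsChain LW) :
    (word (L ++ [s]))⁻¹ * δ ^ ((L ++ [s]).length : ℤ) ⊓ δ = val (comp s) := by
  induction L using List.reverseRecOn generalizing s with
  | nil =>
    have h1 : (word ([] ++ [s]))⁻¹ * δ ^ (([] ++ [s] : List NC).length : ℤ) = val (comp s) := by
      simp [word, val_comp, compl]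
    rw [h1]
    exact inf_eq_left.2 (val_le_delta _)
  | append_singleton L t ih =>
    have hc : (L ++ [t]).IsChain LW ∧ LW t s := by
      rw [List.append_assoc, List.isChain_append] at h
      obtain ⟨h1, h2, h3⟩ := h
      refine ⟨List.isChain_append.2 ⟨h1, by simp, fun x hx y hy => h3 x hx y ?_⟩, ?_⟩
      · simpa using hy
      · simpa using h2
    set A := (word (L ++ [t]))⁻¹ * δ ^ ((L ++ [t]).length : ℤ) with hA
    have h1 : (word (L ++ [t] ++ [s]))⁻¹ * δ ^ ((L ++ [t] ++ [s]).length : ℤ) =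
        (val s)⁻¹ * (A * δ) := by
      rw [word_append _ [s], mul_inv_rev, List.length_append (bs := [s]), hA]
      simp only [word_cons, word_nil, mul_one, mul_assoc, List.length_singleton, Nat.cast_add,
        Nat.cast_one, zpow_add_one]
    have h2 : A ⊓ val s = 1 := by
      rw [← inf_eq_right.2 (val_le_delta s), ← inf_assoc, ih hc.1, ← val_cap, ← val_zero]
      exact congrArg val hc.2
    have h3 : (val s)⁻¹ * (A * δ) ⊓ δ = (val s)⁻¹ * ((A ⊓ val s) * δ) := by
      rw [inf_mul_delta, mul_inf_eq, ← mul_assoc _ (val s), inv_mul_cancel, one_mul]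
    rw [h1, h3, h2, one_mul, val_comp, compl]

/-- With `compl_finalFactor_eq`, this expresses the preferred prefix purely by meets and δ, which is
the origin of `slideMap`. -/
theorem initialFactor_eq {p : ℤ} {s : NC} {L : List NC}
    (h : Normal (s :: L) ∧ (s :: L).head? ≠ some 13) :
    initialFactor (eval (p, s :: L)) = eval (p, s :: L) * δ ^ (-p) ⊓ δ := by
  have h1 : δ ^ p * δ * δ ^ (-p) = δ := by
    rw [← zpow_add_one, ← zpow_add]; simp
  rw [initialFactor_eval h, ← conj_val_delta_zpow, ← word_inf_delta h.1.1, conj, zpow_neg, inv_inv,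
    ← zpow_neg, mul_inf_eq, inf_mul_delta_zpow, h1, eval]

theorem compl_finalFactor_eq {p : ℤ} {L : List NC} (hL : L ≠ [])
    (h : Normal L ∧ L.head? ≠ some 13) :
    compl (finalFactor (eval (p, L))) =
      (eval (p, L))⁻¹ * δ ^ (p + L.length) ⊓ δ := by
  obtain ⟨M, s, rfl⟩ := (List.eq_nil_or_concat' L).resolve_left hL
  rw [finalFactor_eval h, ← val_comp, ← word_inv_inf_delta h.1.1, eval, mul_inv_rev, zpow_add,
    mul_assoc, inv_mul_cancel_left]

/-! ### Infimum, supremum and the sliding map -/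

/-- The supremum of a braid. -/
noncomputable def sup (x : B4) : ℤ := inf x + len x

theorem delta_zpow_le_iff {x : B4} {q : ℤ} : δ ^ q ≤ x ↔ q ≤ inf x := by
  obtain ⟨p, L, h, rfl⟩ := exists_eval x
  rw [delta_zpow_le_eval_iff p q h, inf_eval h]

theorem le_delta_zpow_iff {x : B4} {q : ℤ} : x ≤ δ ^ q ↔ sup x ≤ q := by
  obtain ⟨p, L, h, rfl⟩ := exists_eval x
  rw [sup, inf_eval h, len_eval h]
  refine ⟨fun hq => ?_, fun hq => (eval_le_delta_zpow p L).trans (delta_zpow_le hq)⟩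
  by_contra hlt
  have h1 : eval (p, L) ≤ δ ^ (p + L.length - 1) := hq.trans (delta_zpow_le (by omega))
  rcases List.eq_nil_or_concat' L with rfl | ⟨M, s, rfl⟩
  · have h2 := weight_le_of_le ((delta_zpow_le_eval p []).trans h1)
    rw [weight_delta_zpow, weight_delta_zpow] at h2
    simp at h2
  · have h2 := compl_finalFactor_eq (p := p) (by simp) h
    have h3 : δ ≤ (eval (p, M ++ [s]))⁻¹ * δ ^ (p + (M ++ [s]).length) := by
      have h4 := mul_delta_le_iff.2 (le_inv_mul_iff_le.2 h1)
      rwa [one_mul, mul_assoc, ← zpow_add_one, sub_add_cancel] at h4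
    rw [inf_eq_right.2 h3, finalFactor_eval h, compl, mul_eq_right, inv_eq_one, ← val_zero,
      val_injective.eq_iff] at h2
    exact h.1.2 (by simp [h2])

theorem delta_zpow_inf_le (x : B4) : δ ^ inf x ≤ x := delta_zpow_le_iff.2 le_rfl

theorem le_delta_zpow_sup (x : B4) : x ≤ δ ^ sup x := le_delta_zpow_iff.2 le_rfl

/-- The map describing cyclic sliding, relative to bounds `p` and `q` for the infimum and the
supremum of `y`. -/
noncomputable def slideMap (p q : ℤ) (y g : B4) : B4 :=
  y * g * δ ^ (-p) ⊓ y⁻¹ * g * δ ^ q ⊓ g * δ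

theorem preferredPrefix_eq {x : B4} (h : 1 ≤ len x) :
    preferredPrefix x = slideMap (inf x) (sup x) x 1 := by
  obtain ⟨p, L, hL, rfl⟩ := exists_eval x
  rw [len_eval hL] at h
  cases L with
  | nil => simp at h
  | cons s L =>
    rw [preferredPrefix, meet_eq, initialFactor_eq hL, compl_finalFactor_eq (by simp) hL, slideMap,
      sup, inf_eval hL, len_eval hL, mul_one, mul_one, one_mul, ← inf_inf_distrib_right]

theorem isRigid_iff {x : B4} :
    IsRigid x ↔ 1 ≤ len x ∧ slideMap (inf x) (sup x) x 1 = 1 := by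
  refine and_congr_right fun h => ?_
  rw [← preferredPrefix_eq h, LeftWeighted, isMeet_iff, preferredPrefix, meet_eq, inf_comm, eq_comm]

theorem sliding_eq (x : B4) : sliding x = conj x (slideMap (inf x) (sup x) x 1) := by
  rw [sliding]
  split_ifs with h
  · obtain ⟨p, L, hL, rfl⟩ := exists_eval x
    rw [len_eval hL] at h
    obtain rfl : L = [] := List.length_eq_zero_iff.1 h
    have h1 : eval (p, []) = δ ^ p := by simp [eval, word]
    rw [sup, inf_eval hL, len_eval hL, h1, slideMap]
    simp only [mul_one, one_mul, zpow_neg, mul_inv_cancel, List.length_nil, Nat.cast_zero,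
      add_zero, inv_mul_cancel, le_refl, inf_of_le_left, inf_eq_left.2 one_le_delta]
    simp [conj]
  · rw [preferredPrefix_eq (by omega)]

/-- For length at most one, weight alone, a conjugacy invariant, prevents a conjugate from having
larger infimum or smaller supremum. Longer elements need the sliding argument. -/
theorem weight_bounds_of_len_le_one {x : B4} (h : len x ≤ 1) :
    weight x < 3 * (inf x + 1) ∧ 3 * (sup x - 1) < weight x := by
  obtain ⟨p, L, hL, rfl⟩ := exists_eval x
  rw [len_eval hL] at h
  rw [sup, inf_eval hL, len_eval hL, eval, weight_mul, weight_delta_zpow]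
  rcases L with _ | ⟨s, _ | ⟨t, L⟩⟩
  · rw [word_nil, weight_one]
    simp
  · have h0 : s ≠ 0 := fun h => hL.1.2 (by simp [h])
    have h13 : s ≠ 13 := by simpa using hL.2
    have hr : ∀ s : NC, s ≠ 0 → s ≠ 13 → 1 ≤ rk s ∧ rk s ≤ 2 := by decide +kernel
    rw [word_cons, word_nil, mul_one, weight_val]
    have := hr s h0 h13
    simp
    omega
  · simp at h

/-! ### Conjugacy and cyclic sliding -/

theorem conj_one (x : B4) : conj x 1 = x := by simp [conj]

theorem conj_conj (x g h : B4) : conj (conj x g) h = conj x (g * h) := by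
  simp [conj, mul_assoc]

theorem conj_inv (x g : B4) : conj x⁻¹ g = (conj x g)⁻¹ := by
  simp [conj, mul_assoc]

theorem mul_conj (x g : B4) : g * conj x g = x * g := by
  simp [conj, mul_assoc]

theorem weight_conj (x g : B4) : weight (conj x g) = weight x := by
  simp only [conj, weight_mul, weight_inv]
  omega

theorem le_conj_iff {z x g : B4} : z ≤ conj x g ↔ g * z ≤ x * g := by
  rw [conj, mul_assoc, le_inv_mul_iff_mul_le]

theorem conj_le_iff {z x g : B4} : conj x g ≤ z ↔ x * g ≤ g * z := by
  rw [conj, mul_assoc, inv_mul_le_iff_le_mul]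

section slideMap

variable (p q : ℤ) (y : B4)

theorem slideMap_inf (g h : B4) :
    slideMap p q y (g ⊓ h) = slideMap p q y g ⊓ slideMap p q y h := by
  simp only [slideMap, mul_inf_eq, inf_mul_delta_zpow, inf_mul_delta]
  simp only [inf_left_comm, inf_comm]

theorem slideMap_mono : Monotone (slideMap p q y) := fun g h hgh => by
  rw [← inf_eq_left, ← slideMap_inf, inf_eq_left.2 hgh]

theorem slideMap_mul_delta_zpow (g : B4) (k : ℤ) :
    slideMap p q y (g * δ ^ k) = slideMap p q y g * δ ^ k := by
  have h : ∀ j : ℤ, δ ^ k * δ ^ j = δ ^ j * δ ^ k := fun j => by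
    rw [← zpow_add, add_comm, zpow_add]
  have h1 : δ ^ k * δ = δ * δ ^ k := by simpa using h 1
  simp only [slideMap, inf_mul_delta_zpow, mul_assoc, h, h1]

/-- The maps attached to conjugate elements are translates of one another, so successive slidings
become iterates of one fixed map. -/
theorem mul_slideMap_conj (g h : B4) :
    g * slideMap p q (conj y g) h = slideMap p q y (g * h) := by
  simp only [slideMap, mul_inf_eq, ← conj_inv, ← mul_assoc, mul_conj]

theorem slideMap_le_mul_delta (g : B4) : slideMap p q y g ≤ g * δ := inf_le_right

theorem slideMap_inv (g : B4) : slideMap (-q) (-p) y⁻¹ g = slideMap p q y g := by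
  rw [slideMap, slideMap, neg_neg, inv_inv, inf_comm (y⁻¹ * g * δ ^ q)]

variable {p q y}

theorem le_slideMap_one (hp : δ ^ p ≤ y) (hq : y ≤ δ ^ q) : 1 ≤ slideMap p q y 1 := by
  refine le_inf (le_inf ?_ ?_) ?_
  · simpa using mul_delta_zpow_le hp (-p)
  · rw [mul_one, le_inv_mul_iff_mul_le, mul_one]; exact hq
  · rw [one_mul]; exact one_le_delta

theorem le_conj_slideMap_one (hp : δ ^ p ≤ y) (hq : y ≤ δ ^ q) :
    δ ^ p ≤ conj y (slideMap p q y 1) := by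
  rw [le_conj_iff]
  refine le_trans ?_ (le_mul_of_one_le_right' (le_slideMap_one hp hq))
  have h : slideMap p q y 1 ≤ y * δ ^ (-p) := by
    simpa [slideMap] using inf_le_left.trans (inf_le_left (a := y * 1 * δ ^ (-p)))
  simpa using mul_delta_zpow_le h p

theorem conj_slideMap_one_le (hp : δ ^ p ≤ y) (hq : y ≤ δ ^ q) :
    conj y (slideMap p q y 1) ≤ δ ^ q := by
  have h1 : δ ^ (-q) ≤ y⁻¹ := by
    rw [zpow_neg]
    have h := mul_delta_zpow_le (le_inv_mul_iff_mul_le.2 (show y * 1 ≤ δ ^ q by simpa using hq)) (-q)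
    simpa using h
  have h2 : y⁻¹ ≤ δ ^ (-p) := by
    have h := mul_delta_zpow_le hp (-p)
    rw [← zpow_add, add_neg_cancel, zpow_zero] at h
    have h' := mul_le_mul_right h y⁻¹
    rwa [mul_one, inv_mul_cancel_left] at h'
  -- The upper bound for y is the lower bound for its inverse, which has the same sliding map with
  -- the bounds exchanged and negated.
  have h3 := le_conj_slideMap_one h1 h2
  rw [slideMap_inv, conj_inv] at h3
  have h4 := mul_delta_zpow_le (mul_le_mul_right h3 (conj y (slideMap p q y 1))) q
  simpa [mul_assoc] using h4

end slideMap

/-! ### Extremality of infimum and supremum on sliding circuits -/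

theorem inf_le_inf_sliding (x : B4) : inf x ≤ inf (sliding x) := by
  rw [← delta_zpow_le_iff, sliding_eq]
  exact le_conj_slideMap_one (delta_zpow_inf_le x) (le_delta_zpow_sup x)

theorem sup_sliding_le_sup (x : B4) : sup (sliding x) ≤ sup x := by
  rw [← le_delta_zpow_iff, sliding_eq]
  exact conj_slideMap_one_le (delta_zpow_inf_le x) (le_delta_zpow_sup x)

theorem eq_of_periodic_of_le {α : Type*} {f : α → α} {h : α → ℤ} (hf : ∀ a, h a ≤ h (f a))
    {a : α} {k : ℕ} (hk : 1 ≤ k) (ha : f^[k] a = a) (i : ℕ) : h (f^[i] a) = h a := by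
  have hm : Monotone fun i => h (f^[i] a) :=
    monotone_nat_of_le_succ fun i => by rw [Function.iterate_succ_apply']; exact hf _
  have hp : f^[k * i] a = a := by
    rw [Function.iterate_mul]
    exact Function.iterate_fixed ha i
  apply le_antisymm
  · have := hm (Nat.le_mul_of_pos_left i hk)
    simpa [hp] using this
  · exact hm (Nat.zero_le i)

/-- The elements that are periodic under cyclic sliding. -/
def SlidingPeriodic (y : B4) : Prop := ∃ k : ℕ, 1 ≤ k ∧ sliding^[k] y = y

theorem SlidingPeriodic.inf_iterate {y : B4} (hy : SlidingPeriodic y) (i : ℕ) :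
    inf (sliding^[i] y) = inf y := by
  obtain ⟨k, hk, h⟩ := hy
  exact eq_of_periodic_of_le inf_le_inf_sliding hk h i

theorem SlidingPeriodic.sup_iterate {y : B4} (hy : SlidingPeriodic y) (i : ℕ) :
    sup (sliding^[i] y) = sup y := by
  obtain ⟨k, hk, h⟩ := hy
  have := eq_of_periodic_of_le (h := fun x => -sup x)
    (fun x => neg_le_neg (sup_sliding_le_sup x)) hk h i
  simpa using this

theorem SlidingPeriodic.iterate_eq {y : B4} (hy : SlidingPeriodic y) (i : ℕ) :
    sliding^[i] y = conj y ((slideMap (inf y) (sup y) y)^[i] 1) := by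
  induction i with
  | zero => simp [conj_one]
  | succ i ih =>
    rw [Function.iterate_succ_apply', sliding_eq, hy.inf_iterate, hy.sup_iterate, ih, conj_conj,
      mul_slideMap_conj, mul_one, Function.iterate_succ_apply']

/-- The map describing cycling, relative to a bound `p` for the infimum of `y`. -/
noncomputable def cycleMap (p : ℤ) (y g : B4) : B4 := y * g * δ ^ (-p) ⊓ g * δ

section cycleMap

variable (p : ℤ) (y : B4)

theorem delta_mul_delta_zpow (k : ℤ) : δ * δ ^ k = δ ^ k * δ := by
  rw [← zpow_one_add, add_comm, zpow_add_one]

theorem cycleMap_inf (g h : B4) : cycleMap p y (g ⊓ h) = cycleMap p y g ⊓ cycleMap p y h := by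
  simp only [cycleMap, mul_inf_eq, inf_mul_delta_zpow, inf_mul_delta]
  exact inf_inf_inf_comm _ _ _ _

theorem cycleMap_mono : Monotone (cycleMap p y) := fun g h hgh => by
  rw [← inf_eq_left, ← cycleMap_inf, inf_eq_left.2 hgh]

theorem cycleMap_mul_delta_zpow (g : B4) (k : ℤ) :
    cycleMap p y (g * δ ^ k) = cycleMap p y g * δ ^ k := by
  have h : δ ^ k * δ ^ (-p) = δ ^ (-p) * δ ^ k := by rw [← zpow_add, add_comm, zpow_add]
  simp only [cycleMap, inf_mul_delta_zpow, mul_assoc, h, delta_mul_delta_zpow]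

theorem cycleMap_mul_mul_delta_zpow (g : B4) :
    cycleMap p y (y * g * δ ^ (-p)) = y * cycleMap p y g * δ ^ (-p) := by
  simp only [cycleMap, mul_inf_eq, inf_mul_delta_zpow, mul_assoc, delta_mul_delta_zpow]

theorem cycleMap_le (g : B4) : cycleMap p y g ≤ g * δ := inf_le_right

theorem slideMap_eq_inf (q : ℤ) (g : B4) :
    slideMap p q y g = cycleMap p y g ⊓ y⁻¹ * g * δ ^ q := by
  rw [slideMap, cycleMap, inf_right_comm]

theorem slideMap_le_cycleMap (q : ℤ) : slideMap p q y ≤ cycleMap p y := fun g => by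
  rw [slideMap_eq_inf]; exact inf_le_left

theorem cycleMap_iterate_inf (k : ℕ) (g h : B4) :
    (cycleMap p y)^[k] (g ⊓ h) = (cycleMap p y)^[k] g ⊓ (cycleMap p y)^[k] h := by
  induction k generalizing g h with
  | zero => rfl
  | succ k ih => rw [Function.iterate_succ_apply, cycleMap_inf, ih]; rfl

theorem cycleMap_iterate_mul_delta_zpow (k : ℕ) (g : B4) (j : ℤ) :
    (cycleMap p y)^[k] (g * δ ^ j) = (cycleMap p y)^[k] g * δ ^ j := by
  induction k generalizing g with
  | zero => rfl
  | succ k ih => rw [Function.iterate_succ_apply, cycleMap_mul_delta_zpow, ih]; rfl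

theorem cycleMap_iterate_mul_mul_delta_zpow (k : ℕ) (g : B4) :
    (cycleMap p y)^[k] (y * g * δ ^ (-p)) = y * (cycleMap p y)^[k] g * δ ^ (-p) := by
  induction k generalizing g with
  | zero => rfl
  | succ k ih => rw [Function.iterate_succ_apply, cycleMap_mul_mul_delta_zpow, ih]; rfl

variable {p y}

theorem le_conj_iff_mul_delta_le {g : B4} :
    δ ^ (p + 1) ≤ conj y g ↔ g * δ ≤ y * g * δ ^ (-p) := by
  rw [le_conj_iff, ← mul_delta_zpow_le_iff (-p), mul_assoc, ← zpow_add]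
  simp

/-- A conjugator g reaching the larger infimum satisfies F(g) = gδ, where F is `cycleMap`.
Normalised below 1, it forces the iterates of F at 1 to gain weight at average rate 3 per step; so
some step must be a full multiplication by δ, and that property persists. -/
theorem exists_cycleMap_iterate (h : ∃ g, δ ^ (p + 1) ≤ conj y g) :
    ∃ k₀, ∀ k ≥ k₀, δ ^ (p + 1) ≤ conj y ((cycleMap p y)^[k] 1) := by
  simp only [le_conj_iff_mul_delta_le] at h ⊢
  obtain ⟨g, hg, hg1⟩ : ∃ g, g * δ ≤ y * g * δ ^ (-p) ∧ g ≤ 1 := by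
    obtain ⟨g, hg⟩ := h
    obtain ⟨m, -, hm⟩ := exists_delta_bounds g
    refine ⟨g * δ ^ (-m : ℤ), ?_, ?_⟩
    · have h1 : δ ^ (-m : ℤ) * δ ^ (-p) = δ ^ (-p) * δ ^ (-m : ℤ) := by
        rw [← zpow_add, add_comm, zpow_add]
      calc g * δ ^ (-m : ℤ) * δ = g * δ * δ ^ (-m : ℤ) := by
            rw [mul_assoc, ← delta_mul_delta_zpow, mul_assoc]
        _ ≤ y * g * δ ^ (-p) * δ ^ (-m : ℤ) := mul_delta_zpow_le hg _
        _ = y * (g * δ ^ (-m : ℤ)) * δ ^ (-p) := by simp only [mul_assoc, h1]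
    · simpa using mul_delta_zpow_le hm (-m)
  have hk : ∀ k : ℕ, g * δ ^ (k : ℤ) ≤ (cycleMap p y)^[k] 1 := fun k => by
    have : (cycleMap p y)^[k] g = g * δ ^ (k : ℤ) := by
      induction k with
      | zero => simp
      | succ k ih =>
        rw [Function.iterate_succ_apply', ih, cycleMap_mul_delta_zpow, cycleMap,
          inf_eq_right.2 hg, mul_assoc, Nat.cast_add, Nat.cast_one, zpow_add_one,
          delta_mul_delta_zpow]
    rw [← this]
    exact (cycleMap_mono p y).iterate k hg1
  -- Otherwise each step gains at most 2, giving weight at most 2k, against the lower bound 3k +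
  -- weight g; this fails once k exceeds -weight g.
  obtain ⟨k₀, hk₀⟩ : ∃ k, (cycleMap p y)^[k + 1] 1 = (cycleMap p y)^[k] 1 * δ := by
    by_contra! hne
    have hw : ∀ k : ℕ, weight ((cycleMap p y)^[k] 1) ≤ 2 * k := fun k => by
      induction k with
      | zero => simp [weight_one]
      | succ k ih =>
        have h1 : (cycleMap p y)^[k + 1] 1 < (cycleMap p y)^[k] 1 * δ := by
          refine lt_of_le_of_ne ?_ (hne k)
          rw [Function.iterate_succ_apply']
          exact cycleMap_le _ _ _
        have h2 := weight_lt_of_lt h1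
        rw [weight_mul, weight_delta] at h2
        push_cast
        omega
    have h1 := weight_le_of_le (hk ((-weight g).toNat + 1))
    have h2 := hw ((-weight g).toNat + 1)
    rw [weight_mul, weight_delta_zpow] at h1
    omega
  refine ⟨k₀, fun k hk => ?_⟩
  induction k, hk using Nat.le_induction with
  | base =>
    rw [← hk₀, Function.iterate_succ_apply']
    exact inf_le_left
  | succ k _ ih =>
    rw [Function.iterate_succ_apply', ← cycleMap_mul_mul_delta_zpow]
    have := cycleMap_mono p y ih
    have h1 := cycleMap_mul_delta_zpow p y ((cycleMap p y)^[k] 1) 1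
    rw [zpow_one] at h1
    rwa [h1] at this

/-- If some conjugate of `y` is divisible by `δ ^ (p + 1)`, then so are all sufficiently high
iterates of cyclic sliding relative to `p` and `q ≥ p + 2`. -/
theorem exists_slideMap_iterate {q : ℤ} (hpq : p + 2 ≤ q)
    (h : ∃ g, δ ^ (p + 1) ≤ conj y g) :
    ∃ k₀, ∀ k ≥ k₀, δ ^ (p + 1) ≤ conj y ((slideMap p q y)^[k] 1) := by
  obtain ⟨k₀, hk₀⟩ := exists_cycleMap_iterate h
  simp only [le_conj_iff_mul_delta_le] at hk₀ ⊢
  have hFC : ∀ i g, (slideMap p q y)^[i] g ≤ (cycleMap p y)^[i] g := fun i g =>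
    (slideMap_mono p q y).iterate_le_of_le (slideMap_le_cycleMap p y q) i g
  -- Cycling steps are exchanged for sliding steps one at a time; the case i = 0 is the claim.
  -- Sliding is the meet of cycling with y⁻¹ e δ ^ q, and the latter contributes δ ^ (q - p), which
  -- dominates the needed δ ^ 2.
  have key : ∀ k i, k₀ ≤ k + i → (slideMap p q y)^[k + i] 1 * δ ≤
      y * (cycleMap p y)^[i] ((slideMap p q y)^[k] 1) * δ ^ (-p) := by
    intro k
    induction k with
    | zero =>
      intro i hi
      rw [zero_add] at hi ⊢
      exact (mul_delta_le_iff.2 (hFC i 1)).trans (hk₀ i hi)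
    | succ k ih =>
      intro i hi
      set e := (slideMap p q y)^[k] 1 with he
      have hs : (slideMap p q y)^[k + 1] 1 = slideMap p q y e := Function.iterate_succ_apply' _ _ _
      rw [hs, slideMap_eq_inf, cycleMap_iterate_inf, mul_inf_eq, inf_mul_delta_zpow]
      refine le_inf ?_ ?_
      · have := ih (i + 1) (by omega)
        rwa [show k + (i + 1) = k + 1 + i by omega, Function.iterate_succ_apply] at this
      · have h1 : y * (y⁻¹ * e * δ ^ q) * δ ^ (-p) = e * δ ^ (q - p) := by
          rw [sub_eq_add_neg, zpow_add]; group
        rw [← cycleMap_iterate_mul_mul_delta_zpow, h1, add_comm (k + 1) i,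
          Function.iterate_add_apply, hs]
        calc (slideMap p q y)^[i] (slideMap p q y e) * δ
            ≤ (cycleMap p y)^[i] (e * δ ^ (1 : ℤ)) * δ := by
              refine mul_delta_le_iff.2 ((hFC _ _).trans ((cycleMap_mono p y).iterate i ?_))
              rw [zpow_one]
              exact slideMap_le_mul_delta _ _ _ _
          _ = (cycleMap p y)^[i] e * δ ^ (2 : ℤ) := by
              rw [cycleMap_iterate_mul_delta_zpow, mul_assoc, ← zpow_add_one]; rfl
          _ ≤ (cycleMap p y)^[i] e * δ ^ (q - p) := mul_le_mul_right (delta_zpow_le (by omega)) _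
          _ = _ := (cycleMap_iterate_mul_delta_zpow _ _ _ _ _).symm
  exact ⟨k₀, fun k hk => key k 0 (by simpa using hk)⟩

end cycleMap

/-- If a larger infimum were attainable, iterated sliding would attain it, whereas the infimum is
constant along a periodic orbit. -/
theorem SlidingPeriodic.not_le_conj {y : B4} (hy : SlidingPeriodic y) (g : B4) :
    ¬ δ ^ (inf y + 1) ≤ conj y g := by
  intro h
  by_cases hl : len y ≤ 1
  · have h1 := weight_le_of_le h
    have h2 := (weight_bounds_of_len_le_one hl).1
    rw [weight_conj, weight_delta_zpow] at h1
    omega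
  · obtain ⟨k, hk⟩ := exists_slideMap_iterate (q := sup y) (by rw [sup]; omega) ⟨g, h⟩
    have h1 := hk k le_rfl
    rw [← hy.iterate_eq, delta_zpow_le_iff, hy.inf_iterate] at h1
    omega

theorem inv_le_delta_zpow_iff {x : B4} {q : ℤ} : δ ^ (-q) ≤ x⁻¹ ↔ x ≤ δ ^ q := by
  rw [← mul_delta_zpow_le_iff q, zpow_neg, inv_mul_cancel, le_inv_mul_iff_mul_le, mul_one]

theorem SlidingPeriodic.not_conj_le {y : B4} (hy : SlidingPeriodic y) (g : B4) :
    ¬ conj y g ≤ δ ^ (sup y - 1) := by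
  intro h
  by_cases hl : len y ≤ 1
  · have h1 := weight_le_of_le h
    have h2 := (weight_bounds_of_len_le_one hl).2
    rw [weight_conj, weight_delta_zpow] at h1
    omega
  · have h' : δ ^ (-sup y + 1) ≤ conj y⁻¹ g := by
      rwa [conj_inv, show -sup y + 1 = -(sup y - 1) by ring, inv_le_delta_zpow_iff]
    obtain ⟨k, hk⟩ := exists_slideMap_iterate (p := -sup y) (q := -inf y) (by rw [sup]; omega)
      ⟨g, h'⟩
    have h1 := hk k le_rfl
    rw [show slideMap (-sup y) (-inf y) y⁻¹ = slideMap (inf y) (sup y) y from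
      funext fun g => slideMap_inv _ _ _ _, conj_inv, ← hy.iterate_eq,
      show -sup y + 1 = -(sup y - 1) by ring, inv_le_delta_zpow_iff, le_delta_zpow_iff,
      hy.sup_iterate] at h1
    omega

theorem SlidingPeriodic.inf_conj_le {y : B4} (hy : SlidingPeriodic y) (g : B4) :
    inf (conj y g) ≤ inf y := by
  by_contra h
  exact hy.not_le_conj g (delta_zpow_le_iff.2 (by omega))

theorem SlidingPeriodic.le_sup_conj {y : B4} (hy : SlidingPeriodic y) (g : B4) :
    sup y ≤ sup (conj y g) := by
  by_contra h
  exact hy.not_conj_le g (le_delta_zpow_iff.2 (by omega))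

/-! ### Rigid elements and their conjugators -/

theorem sliding_eq_self_of_isRigid {x : B4} (hx : IsRigid x) : sliding x = x := by
  rw [sliding_eq, (isRigid_iff.1 hx).2, conj_one]

theorem IsRigid.slidingPeriodic {x : B4} (hx : IsRigid x) : SlidingPeriodic x :=
  ⟨1, le_rfl, sliding_eq_self_of_isRigid hx⟩

theorem SlidingPeriodic.inf_conj {y g : B4} (hy : SlidingPeriodic y)
    (hg : SlidingPeriodic (conj y g)) : inf (conj y g) = inf y := by
  refine le_antisymm (hy.inf_conj_le g) ?_
  have := hg.inf_conj_le g⁻¹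
  rwa [conj_conj, mul_inv_cancel, conj_one] at this

theorem SlidingPeriodic.sup_conj {y g : B4} (hy : SlidingPeriodic y)
    (hg : SlidingPeriodic (conj y g)) : sup (conj y g) = sup y := by
  refine le_antisymm ?_ (hy.le_sup_conj g)
  have := hg.le_sup_conj g⁻¹
  rwa [conj_conj, mul_inv_cancel, conj_one] at this

theorem slideMap_iterate_delta {p q : ℤ} {x : B4} (hx : slideMap p q x 1 = 1) (m : ℤ) (k : ℕ) :
    (slideMap p q x)^[k] (δ ^ m) = δ ^ m := by
  refine Function.iterate_fixed ?_ k
  have := slideMap_mul_delta_zpow p q x 1 m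
  rwa [hx, one_mul] at this

/-- The elements of the sliding circuits of a rigid element are rigid. -/
theorem IsRigid.isRigid_conj {x g : B4} (hx : IsRigid x) (hg : SlidingPeriodic (conj x g)) :
    IsRigid (conj x g) := by
  have hinf := hx.slidingPeriodic.inf_conj hg
  have hsup := hx.slidingPeriodic.sup_conj hg
  obtain ⟨hlen, hfix⟩ := isRigid_iff.1 hx
  set y := conj x g with hy
  have hlen' : 1 ≤ len y := by
    rw [sup, sup, hinf] at hsup
    omega
  have hmul : ∀ k : ℕ, g * (slideMap (inf y) (sup y) y)^[k] 1 =
      (slideMap (inf x) (sup x) x)^[k] g := by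
    intro k
    induction k with
    | zero => simp
    | succ k ih =>
      rw [Function.iterate_succ_apply', Function.iterate_succ_apply', ← ih, hinf, hsup, hy,
        mul_slideMap_conj]
  obtain ⟨m, -, hm⟩ := exists_delta_bounds g
  -- The map of the rigid x fixes δ ^ m, so the iterates of g ≤ δ ^ m stay below it. The accumulated
  -- conjugators therefore have bounded weight, and some preferred prefix must be trivial.
  have hbound : ∀ k : ℕ, weight ((slideMap (inf y) (sup y) y)^[k] 1) ≤ 3 * m - weight g := by
    intro k
    have h1 := weight_le_of_le ((slideMap_mono (inf x) (sup x) x).iterate k hm)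
    rw [slideMap_iterate_delta hfix, ← hmul, weight_mul, weight_delta_zpow] at h1
    omega
  obtain ⟨k, hk⟩ : ∃ k : ℕ, slideMap (inf y) (sup y) (sliding^[k] y) 1 = 1 := by
    by_contra! hne
    have hw : ∀ k : ℕ, (k : ℤ) ≤ weight ((slideMap (inf y) (sup y) y)^[k] 1) := by
      intro k
      induction k with
      | zero => simp [weight_one]
      | succ k ih =>
        have h1 : 1 ≤ slideMap (inf y) (sup y) (sliding^[k] y) 1 := by
          rw [← hg.inf_iterate k, ← hg.sup_iterate k]
          exact le_slideMap_one (delta_zpow_inf_le _) (le_delta_zpow_sup _)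
        have h2 := weight_lt_of_lt (lt_of_le_of_ne h1 (hne k).symm)
        rw [Function.iterate_succ_apply', ← mul_one ((slideMap (inf y) (sup y) y)^[k] 1),
          ← mul_slideMap_conj, ← hg.iterate_eq, weight_mul]
        rw [weight_one] at h2
        push_cast
        omega
    have h1 := hbound (3 * m - weight g + 1).toNat
    have h2 := hw (3 * m - weight g + 1).toNat
    omega
  have hs : sliding (sliding^[k] y) = sliding^[k] y := by
    rw [sliding_eq, hg.inf_iterate, hg.sup_iterate, hk, conj_one]
  obtain ⟨n, hn, hny⟩ := hg
  -- A periodic orbit that meets a fixed point consists of that point.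
  have hyk : sliding^[k] y = y := by
    have h1 : sliding^[n * k] y = y := by
      rw [Function.iterate_mul]
      exact Function.iterate_fixed hny k
    have h2 : sliding^[n * k - k + k] y = y := by
      rwa [Nat.sub_add_cancel (Nat.le_mul_of_pos_left k hn)]
    rw [Function.iterate_add_apply, Function.iterate_fixed hs] at h2
    exact h2
  rw [hyk] at hk
  exact isRigid_iff.2 ⟨hlen', hk⟩

/-- If two rigid elements are conjugate by `g`, then conjugating by the simple element `g ⊓ δ`
also gives a rigid element. -/
theorem IsRigid.isRigid_conj_inf_delta {x g : B4} (hx : IsRigid x) (hg : IsRigid (conj x g)) :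
    IsRigid (conj x (g ⊓ δ)) := by
  have hinf := hx.slidingPeriodic.inf_conj hg.slidingPeriodic
  have hsup := hx.slidingPeriodic.sup_conj hg.slidingPeriodic
  obtain ⟨hlen, hfix⟩ := isRigid_iff.1 hx
  -- Rigidity of the conjugate says that g is a fixed point of the map of x; δ is one too, and fixed
  -- points are closed under meets.
  have h1 : slideMap (inf x) (sup x) x g = g := by
    have := mul_slideMap_conj (inf x) (sup x) x g 1
    rw [← hinf, ← hsup, (isRigid_iff.1 hg).2, hinf, hsup] at this
    simpa using this.symm
  have h2 : slideMap (inf x) (sup x) x δ = δ := by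
    have := slideMap_mul_delta_zpow (inf x) (sup x) x 1 1
    rwa [hfix, zpow_one, one_mul] at this
  have h3 : slideMap (inf x) (sup x) (conj x (g ⊓ δ)) 1 = 1 := by
    have := mul_slideMap_conj (inf x) (sup x) x (g ⊓ δ) 1
    rwa [mul_one, slideMap_inf, h1, h2, mul_eq_left] at this
  have hδ : ∀ k : ℤ, δ * δ ^ k = δ ^ k * δ := delta_mul_delta_zpow
  have hinf' : inf (conj x (g ⊓ δ)) = inf x := by
    refine le_antisymm (hx.slidingPeriodic.inf_conj_le _) (delta_zpow_le_iff.1 ?_)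
    rw [le_conj_iff, mul_inf_eq, inf_mul_delta_zpow]
    refine inf_le_inf ?_ ?_
    · rw [← le_conj_iff, delta_zpow_le_iff, hinf]
    · rw [hδ]; exact mul_delta_le_iff.2 (delta_zpow_inf_le x)
  have hsup' : sup (conj x (g ⊓ δ)) = sup x := by
    refine le_antisymm (le_delta_zpow_iff.1 ?_) (hx.slidingPeriodic.le_sup_conj _)
    rw [conj_le_iff, mul_inf_eq, inf_mul_delta_zpow]
    refine inf_le_inf ?_ ?_
    · rw [← conj_le_iff, le_delta_zpow_iff, hsup]
    · rw [hδ]; exact mul_delta_le_iff.2 (le_delta_zpow_sup x)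
  refine isRigid_iff.2 ⟨?_, by rw [hinf', hsup', h3]⟩
  rw [sup, sup, hinf'] at hsup'
  omega

/-! ### Commutation squares and ladders -/

namespace NC

/-- The commutation `s y = x t` between simple elements, in terms of normal forms. -/
def Square (s x y t : NC) : Prop := fst s y = fst x t ∧ snd s y = snd x t

instance (s x y t : NC) : Decidable (Square s x y t) :=
  inferInstanceAs (Decidable (_ ∧ _))

/-- Proper simple elements. -/
def Proper (s : NC) : Prop := s ≠ 0 ∧ s ≠ 13

instance : DecidablePred Proper := fun _ => inferInstanceAs (Decidable (_ ∧ _))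

/-- An invariant of commutations `s y = x t` which does not increase along a left-weighted
sequence of commutations. -/
def kind (s x y t : NC) : ℕ :=
  if s = 0 ∧ t = 0 then 2
  else if s = 13 ∧ t = 13 then 9
  else if s = x ∧ t = y then 4
  else if t = comp x ∧ y = comp s then 5
  else match rk s, rk x, rk t with
    | 0, _, _ => 1
    | 1, 1, _ => 0
    | 1, _, 0 => 6
    | 1, _, _ => 7
    | 2, 1, 3 => 10
    | 2, 1, _ => 3
    | 2, _, _ => 11
    | _, _, _ => 8

/-- The labels are numbered so that every transition permitted by left-weightedness goes weakly
downward; this is a finite check. -/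
theorem kind_le : ∀ s x : NC, Proper x → ∀ y, Proper y → ∀ t, Square s x y t →
    ∀ x', LW x x' → Proper x' → ∀ y', LW y y' → Proper y' → ∀ t', Square t x' y' t' →
      kind t x' y' t' ≤ kind s x y t := by
  decide +kernel

/-- The first four labels determine the conjugator. The remaining ones determine the weight of x, so
a ladder of constant label of that type cannot have factors of both weights. -/
theorem kind_cases : ∀ s x : NC, Proper x → ∀ y, Proper y → ∀ t, Square s x y t →
    (kind s x y t = 2 ∧ s = 0) ∨ (kind s x y t = 9 ∧ s = 13) ∨ (kind s x y t = 4 ∧ s = x) ∨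
      (kind s x y t = 5 ∧ t = comp x) ∨ (kind s x y t ∈ [0, 1, 3, 10] ∧ rk x = 1) ∨
      (kind s x y t ∈ [6, 7, 8, 11] ∧ rk x = 2) := by
  decide +kernel

theorem zpow_rot_comp (k : ℤ) (s : NC) : comp ((rot ^ k) s) = (rot ^ k) (comp s) := by
  have h := zpow_rot_induction (p := fun s t => comp s = t)
    (fun s t => by rw [rot_comp, rot.injective.eq_iff]) k s (comp s)
  exact h.2 rfl

theorem zpow_rot_eq_zero_iff (k : ℤ) (s : NC) : (rot ^ k) s = 0 ↔ s = 0 := by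
  rw [← (rot ^ k).injective.eq_iff (a := s) (b := 0), zpow_rot_zero]

theorem zpow_rot_eq_top_iff (k : ℤ) (s : NC) : (rot ^ k) s = 13 ↔ s = 13 := by
  rw [← (rot ^ k).injective.eq_iff (a := s) (b := 13), zpow_rot_top]

theorem zpow_rot_proper {k : ℤ} {s : NC} : Proper ((rot ^ k) s) ↔ Proper s := by
  rw [Proper, Proper, Ne, Ne, zpow_rot_eq_zero_iff, zpow_rot_eq_top_iff]

theorem kind_zpow_rot (k : ℤ) (s x y t : NC) :
    kind ((rot ^ k) s) ((rot ^ k) x) ((rot ^ k) y) ((rot ^ k) t) = kind s x y t := by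
  simp only [kind, zpow_rot_comp, zpow_rot_eq_zero_iff, zpow_rot_eq_top_iff, zpow_rot_rk,
    (rot ^ k).injective.eq_iff]

end NC

theorem square_iff {s x y t : NC} : Square s x y t ↔ val s * val y = val x * val t := by
  rw [← val_fst_mul_val_snd s y, ← val_fst_mul_val_snd x t]
  refine ⟨fun h => by rw [h.1, h.2], fun h => ?_⟩
  -- The pair is left-weighted, so its first factor is the greatest simple prefix of the product.
  have key : ∀ s y : NC, val (fst s y) * val (snd s y) ⊓ δ = val (fst s y) := fun s y => by
    have := word_inf_delta (s := fst s y) (L := [snd s y]) (by simpa using fst_snd_lw s y)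
    simpa [word] using this
  have h1 : val (fst s y) = val (fst x t) := by rw [← key, h, key]
  refine ⟨val_injective h1, val_injective ?_⟩
  rwa [h1, mul_left_cancel_iff] at h

theorem square_zpow_rot {s x y t : NC} (h : Square s x y t) (k : ℤ) :
    Square ((rot ^ k) s) ((rot ^ k) x) ((rot ^ k) y) ((rot ^ k) t) := by
  rw [square_iff] at h ⊢
  have h1 := word_mul_delta_zpow [s, y] k
  have h2 := word_mul_delta_zpow [x, t] k
  simp only [word_cons, word_nil, mul_one, List.map_cons, List.map_nil] at h1 h2
  rw [h, h2] at h1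
  exact (mul_left_cancel h1).symm

/-- Sequences of commutations `s y₁ = x₁ s₁`, `s₁ y₂ = x₂ s₂`, …, ending with `t`, all of which
satisfy `P`. -/
def Ladder (P : NC → NC → NC → NC → Prop) : NC → List NC → List NC → NC → Prop
  | s, [], [], t => s = t
  | s, x :: L, y :: M, t => ∃ u, P s x y u ∧ Ladder P u L M t
  | _, _, _, _ => False

theorem Ladder.exists_of_mem {P : NC → NC → NC → NC → Prop} {s t : NC} {L M : List NC}
    (h : Ladder P s L M t) {x : NC} (hx : x ∈ L) : ∃ s, ∃ y ∈ M, ∃ u, P s x y u := by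
  induction L generalizing s M with
  | nil => simp at hx
  | cons z L ih =>
    cases M with
    | nil => exact h.elim
    | cons y M =>
      obtain ⟨u, hu, h⟩ := h
      rcases List.mem_cons.1 hx with rfl | hx
      · exact ⟨s, y, by simp, u, hu⟩
      · obtain ⟨s', y', hy', h'⟩ := ih h hx
        exact ⟨s', y', List.mem_cons_of_mem _ hy', h'⟩

theorem Ladder.exists_of_append {P : NC → NC → NC → NC → Prop} {s t x : NC} {L M : List NC}
    (h : Ladder P s (L ++ [x]) M t) : ∃ s, ∃ y ∈ M, P s x y t := by
  induction L generalizing s M with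
  | nil =>
    rcases M with _ | ⟨y, _ | ⟨z, M⟩⟩
    · exact h.elim
    · obtain ⟨u, hu, rfl⟩ := h
      exact ⟨s, y, by simp, hu⟩
    · obtain ⟨u, hu, h⟩ := h
      exact h.elim
  | cons z L ih =>
    cases M with
    | nil => exact h.elim
    | cons y M =>
      obtain ⟨u, hu, h⟩ := h
      obtain ⟨s', y', hy', h'⟩ := ih h
      exact ⟨s', y', List.mem_cons_of_mem _ hy', h'⟩

/-- The quotient u = x⁻¹ s y is simple: s y is the meet of s · word M with s δ, both above x, and it
lies below word (x :: L) · δ and δ², whose meet is x δ. The argument then repeats with u. -/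
theorem ladder_of_eq {s t : NC} {L M : List NC} (hlen : L.length = M.length)
    (hL : L.IsChain LW) (hM : M.IsChain LW) (h : val s * word M = word L * val t) :
    Ladder Square s L M t := by
  induction L generalizing s M with
  | nil =>
    obtain rfl : M = [] := List.length_eq_zero_iff.1 hlen.symm
    simpa [word, Ladder, val_injective.eq_iff] using h
  | cons x L ih =>
    rcases M with _ | ⟨y, M⟩
    · simp at hlen
    · have h1 : 1 ≤ (val x)⁻¹ * (val s * val y) := by
        rw [le_inv_mul_iff_mul_le, mul_one, ← word_inf_delta hM, mul_inf_eq, h]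
        refine le_inf ?_ ((val_le_delta x).trans ?_)
        · rw [word_cons, mul_assoc]
          exact le_mul_of_one_le_right' (one_le_mul (one_le_word L) (one_le_val t))
        · rw [val_mul_delta]
          exact le_mul_of_one_le_right' (one_le_val _)
      have h2 : (val x)⁻¹ * (val s * val y) ≤ δ := by
        rw [inv_mul_le_iff_le_mul]
        have h3 : val s * val y ≤ word (x :: L) * δ := by
          refine le_trans ?_ (mul_le_mul_right (val_le_delta t) _)
          rw [← h, word_cons]
          exact mul_le_mul_right (le_mul_of_one_le_right' (one_le_word M)) _
        have h4 : val s * val y ≤ δ * δ := by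
          refine (mul_le_mul_right (val_le_delta y) _).trans ?_
          exact mul_delta_le_iff.2 (val_le_delta s)
        have h5 := le_inf h3 h4
        rwa [← inf_mul_delta, word_inf_delta hL] at h5
      obtain ⟨u, hu⟩ := exists_val_of_le_delta h1 h2
      have hsq : val s * val y = val x * val u := by rw [hu, mul_inv_cancel_left]
      refine ⟨u, square_iff.2 hsq, ih (by simpa using hlen) hL.tail hM.tail ?_⟩
      rw [word_cons, word_cons, ← mul_assoc, hsq, mul_assoc, mul_assoc, mul_right_inj] at h
      exact h

/-- The label decreases weakly along the ladder up to the extra square at x', y'. By `hle` it starts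
no higher than that square's label, so it is constant. -/
theorem Ladder.kind_eq {s t x' y' u' : NC} {L M : List NC} (h : Ladder Square s L M t)
    (hL : (L ++ [x']).IsChain LW) (hM : (M ++ [y']).IsChain LW) (hLp : ∀ x ∈ L ++ [x'], Proper x)
    (hMp : ∀ y ∈ M ++ [y'], Proper y) (hu' : Square t x' y' u')
    (hle : ∀ x ∈ L.head?, ∀ y ∈ M.head?, ∀ u, Square s x y u → kind s x y u ≤ kind t x' y' u') :
    Ladder (fun s x y u => Square s x y u ∧ kind s x y u = kind t x' y' u') s L M t := by
  induction L generalizing s M with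
  | nil =>
    cases M with
    | nil => exact h
    | cons y M => exact h.elim
  | cons x L ih =>
    cases M with
    | nil => exact h.elim
    | cons y M =>
      obtain ⟨u, hu, h⟩ := h
      have hle' := hle x (by simp) y (by simp) u hu
      have hx : Proper x := hLp x (by simp)
      have hy : Proper y := hMp y (by simp)
      have hL' : ∀ z ∈ L ++ [x'], Proper z := fun z hz => hLp z (List.mem_cons_of_mem _ hz)
      have hM' : ∀ z ∈ M ++ [y'], Proper z := fun z hz => hMp z (List.mem_cons_of_mem _ hz)
      have key := ih h hL.tail hM.tail hL' hM'
      rcases L with _ | ⟨x₂, L⟩ <;> rcases M with _ | ⟨y₂, M⟩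
      · obtain rfl : u = t := h
        refine ⟨u, ⟨hu, le_antisymm hle' ?_⟩, rfl⟩
        exact kind_le s x hx y hy u hu x' (by simpa using hL) (hLp x' (by simp)) y'
          (by simpa using hM) (hMp y' (by simp)) u' hu'
      · exact h.elim
      · exact h.elim
      · have step : ∀ u₂, Square u x₂ y₂ u₂ → kind u x₂ y₂ u₂ ≤ kind s x y u := fun u₂ hu₂ =>
          kind_le s x hx y hy u hu x₂ (List.isChain_cons_cons.1 hL).1 (hL' x₂ (by simp)) y₂
            (List.isChain_cons_cons.1 hM).1 (hM' y₂ (by simp)) u₂ hu₂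
        have h2 := key (by
          intro a ha b hb u₂ hu₂
          simp only [List.head?_cons, Option.mem_def, Option.some.injEq] at ha hb
          subst ha hb
          exact (step u₂ hu₂).trans hle')
        refine ⟨u, ⟨hu, le_antisymm hle' ?_⟩, h2⟩
        obtain ⟨u₂, ⟨hu₂, hk⟩, -⟩ := h2
        rw [← hk]
        exact step u₂ hu₂

/-- The words `x₁, …, x_r` for which `δ ^ p x₁ ⋯ x_r` is the normal form of a rigid element. -/
structure RigidWord (p : ℤ) (L : List NC) : Prop where
  ne_nil : L ≠ []
  proper : ∀ x ∈ L, Proper x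
  chain : ∀ x ∈ L.head?, (L ++ [(rot ^ (-p)) x]).IsChain LW

theorem RigidWord.isNF {p : ℤ} {L : List NC} (h : RigidWord p L) :
    Normal L ∧ L.head? ≠ some 13 := by
  obtain ⟨x, M, rfl⟩ := List.exists_cons_of_ne_nil h.ne_nil
  refine ⟨⟨(List.isChain_append.1 (h.chain x rfl)).1, fun h0 => (h.proper 0 h0).1 rfl⟩, ?_⟩
  intro h13
  exact (h.proper 13 (List.mem_of_mem_head? h13)).2 rfl

theorem Normal.proper {L : List NC} (h : Normal L) (h13 : L.head? ≠ some 13) :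
    ∀ x ∈ L, Proper x := by
  induction L with
  | nil => simp
  | cons x L ih =>
    have hx : x ≠ 13 := by simpa using h13
    intro y hy
    rcases List.mem_cons.1 hy with rfl | hy
    · exact ⟨fun h0 => h.2 (by simp [h0]), hx⟩
    · refine ih h.tail (fun h' => ?_) y hy
      obtain ⟨N, rfl⟩ := List.head?_eq_some_iff.1 h'
      exact hx (lw_top x (List.isChain_cons_cons.1 h.1).1)

theorem rigidWord_iff {p : ℤ} {L : List NC} (h : Normal L ∧ L.head? ≠ some 13) :
    RigidWord p L ↔ IsRigid (eval (p, L)) := by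
  rw [IsRigid, len_eval h]
  constructor
  · intro hL
    obtain ⟨x, M, hx⟩ := List.exists_cons_of_ne_nil hL.ne_nil
    obtain ⟨N, y, hy⟩ := (List.eq_nil_or_concat' L).resolve_left hL.ne_nil
    refine ⟨by simp [hx], ?_⟩
    have h1 : finalFactor (eval (p, L)) = val y := by subst hy; exact finalFactor_eval h
    have h2 : initialFactor (eval (p, L)) = val ((rot ^ (-p)) x) := by
      subst hx; exact initialFactor_eval h
    rw [h1, h2, leftWeighted_val_iff]
    have h3 := (List.isChain_append.1 (hL.chain x (by simp [hx]))).2.2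
    exact h3 y (by simp [hy]) _ (by simp)
  · rintro ⟨hlen, hw⟩
    have hne : L ≠ [] := by rintro rfl; simp at hlen
    refine ⟨hne, h.1.proper h.2, fun x hx => ?_⟩
    obtain ⟨M, rfl⟩ := List.head?_eq_some_iff.1 hx
    obtain ⟨N, y, hy⟩ := (List.eq_nil_or_concat' (x :: M)).resolve_left hne
    have h1 : finalFactor (eval (p, x :: M)) = val y := by
      have h' := h
      rw [hy] at h' ⊢
      exact finalFactor_eval h'
    rw [h1, initialFactor_eval h, leftWeighted_val_iff] at hw
    refine List.isChain_append.2 ⟨h.1.1, by simp, ?_⟩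
    intro a ha b hb
    rw [hy] at ha
    simp only [List.getLast?_append, List.getLast?_singleton, Option.some_or, List.head?_cons,
      Option.mem_def, Option.some.injEq] at ha hb
    rw [← ha, ← hb]
    exact hw

/-- The simple elements that conjugate a rigid element with factors of weights `1` and `2` to a
rigid element. -/
theorem RigidWord.eq_of_conj {p : ℤ} {L M : List NC} {t : NC} (hL : RigidWord p L)
    (hM : RigidWord p M) (hlen : L.length = M.length) (h1 : ∃ s ∈ L, rk s = 1)
    (h2 : ∃ s ∈ L, rk s = 2) (h : conj (eval (p, L)) (val t) = eval (p, M)) :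
    t = 0 ∨ t = 13 ∨ (∃ x ∈ L.head?, t = (rot ^ (-p)) x) ∨ ∃ x ∈ L.getLast?, t = comp x := by
  have hw : val ((rot ^ p) t) * word M = word L * val t := by
    have h' := mul_conj (eval (p, L)) (val t)
    rw [h] at h'
    simp only [eval] at h'
    rw [← mul_assoc, val_mul_delta_zpow, mul_assoc, mul_assoc, mul_right_inj] at h'
    exact h'
  have hlad := ladder_of_eq hlen hL.isNF.1.1 hM.isNF.1.1 hw
  obtain ⟨x, L', rfl⟩ := List.exists_cons_of_ne_nil hL.ne_nil
  obtain ⟨y, M', rfl⟩ := List.exists_cons_of_ne_nil hM.ne_nil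
  obtain ⟨u, hu, -⟩ := id hlad
  -- The ladder closes up: the square that would follow the last one is a rotation of the first,
  -- hence has the same label.
  have hsq := square_zpow_rot hu (-p)
  rw [← Equiv.Perm.mul_apply, ← zpow_add, neg_add_cancel, zpow_zero, Equiv.Perm.one_apply] at hsq
  have hk := kind_zpow_rot (-p) ((rot ^ p) t) x y u
  rw [← Equiv.Perm.mul_apply, ← zpow_add, neg_add_cancel, zpow_zero, Equiv.Perm.one_apply] at hk
  have hproper : ∀ {N : List NC} {z : NC}, RigidWord p (z :: N) →
      ∀ a ∈ z :: N ++ [(rot ^ (-p)) z], Proper a := fun hN a ha => by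
    rcases List.mem_append.1 ha with ha | ha
    · exact hN.proper a ha
    · rw [List.mem_singleton.1 ha, zpow_rot_proper]
      exact hN.proper _ (by simp)
  have hK := hlad.kind_eq (hL.chain x rfl) (hM.chain y rfl) (hproper hL) (hproper hM) hsq (by
    intro a ha b hb v hv
    simp only [List.head?_cons, Option.mem_def, Option.some.injEq] at ha hb
    subst ha hb
    have : u = v := by
      rw [square_iff] at hu hv
      exact val_injective (mul_left_cancel (hu.symm.trans hv))
    rw [hk, this])
  rw [hk] at hK
  rcases kind_cases _ x (hL.proper x (by simp)) y (hM.proper y (by simp)) u hu with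
    ⟨hc, hs⟩ | ⟨hc, hs⟩ | ⟨hc, hs⟩ | ⟨hc, -⟩ | ⟨hc, -⟩ | ⟨hc, -⟩
  · exact Or.inl ((zpow_rot_eq_zero_iff p t).1 hs)
  · exact Or.inr (Or.inl ((zpow_rot_eq_top_iff p t).1 hs))
  · refine Or.inr (Or.inr (Or.inl ⟨x, rfl, ?_⟩))
    rw [← hs, ← Equiv.Perm.mul_apply, ← zpow_add, neg_add_cancel, zpow_zero, Equiv.Perm.one_apply]
  · refine Or.inr (Or.inr (Or.inr ?_))
    -- Label 5 describes the exit side of a square, so it is read at the last one, whose exit side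
    -- is t.
    obtain ⟨N, z, hz⟩ := (List.eq_nil_or_concat' (x :: L')).resolve_left hL.ne_nil
    rw [hz] at hK ⊢
    refine ⟨z, by simp, ?_⟩
    obtain ⟨s', y', hy', hsq', hk'⟩ := hK.exists_of_append
    have := kind_cases s' z (hL.proper z (by simp [hz])) y' (hM.proper y' hy') t hsq'
    rw [hk', hc] at this
    simpa using this
  · obtain ⟨z, hz, hr⟩ := h2
    obtain ⟨s', y', hy', u', hsq', hk'⟩ := hK.exists_of_mem hz
    have := kind_cases s' z (hL.proper z hz) y' (hM.proper y' hy') u' hsq'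
    rw [hk', hr] at this
    simp only [List.mem_cons, List.not_mem_nil, or_false] at hc this
    omega
  · obtain ⟨z, hz, hr⟩ := h1
    obtain ⟨s', y', hy', u', hsq', hk'⟩ := hK.exists_of_mem hz
    have := kind_cases s' z (hL.proper z hz) y' (hM.proper y' hy') u' hsq'
    rw [hk', hr] at this
    simp only [List.mem_cons, List.not_mem_nil, or_false] at hc this
    omega

/-! ### Orbits of rigid elements -/

theorem tau_eval (p : ℤ) (L : List NC) : τ (eval (p, L)) = eval (p, L.map rot) := by
  have h := word_mul_delta_zpow L 1
  simp only [zpow_one] at h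
  rw [τ, conj, eval, eval, mul_assoc, mul_assoc, h, ← mul_assoc, ← mul_assoc, mul_assoc δ⁻¹,
    ← delta_mul_delta_zpow, inv_mul_cancel_left]

theorem tau_iterate_eval (p : ℤ) (L : List NC) (k : ℕ) :
    τ^[k] (eval (p, L)) = eval (p, L.map (rot ^ k)) := by
  induction k with
  | zero => simp
  | succ k ih =>
    rw [Function.iterate_succ_apply', ih, tau_eval, List.map_map, pow_succ']
    rfl

theorem tau_iterate_four (x : B4) : τ^[4] x = x := by
  obtain ⟨p, L, -, rfl⟩ := exists_eval x
  rw [tau_iterate_eval, rot_pow_four]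
  simp

theorem tau_iterate_mod (k : ℕ) (x : B4) : τ^[k] x = τ^[k % 4] x := by
  conv_lhs => rw [← Nat.mod_add_div k 4]
  rw [Function.iterate_add_apply, Function.iterate_mul,
    Function.iterate_fixed (tau_iterate_four x)]

theorem tau_iterate_eq_conj (k : ℕ) (x : B4) : τ^[k] x = conj x (δ ^ (k : ℤ)) := by
  induction k with
  | zero => simp [conj_one]
  | succ k ih =>
    rw [Function.iterate_succ_apply', ih, τ, conj_conj, ← zpow_add_one, Nat.cast_add, Nat.cast_one]

theorem exists_eval_map_zpow_rot (j : ℤ) :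
    ∃ k : ℕ, ∀ p L, eval (p, L.map (rot ^ j)) = τ^[k] (eval (p, L)) := by
  obtain ⟨k, hk⟩ : ∃ k : ℕ, rot ^ j = rot ^ k := by
    refine ⟨(j % 4).toNat, ?_⟩
    rw [← zpow_natCast, Int.toNat_of_nonneg (Int.emod_nonneg _ (by norm_num))]
    conv_lhs => rw [← Int.emod_add_mul_ediv j 4, zpow_add, zpow_mul]
    simp [zpow_ofNat, rot_pow_four]
  exact ⟨k, fun p L => by rw [tau_iterate_eval, hk]⟩

theorem normal_map_rot {L : List NC} (h : Normal L ∧ L.head? ≠ some 13) :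
    Normal (L.map rot) ∧ (L.map rot).head? ≠ some 13 := by
  refine ⟨⟨?_, ?_⟩, ?_⟩
  · rw [List.isChain_map]
    exact h.1.1.imp fun _ _ => (rot_lw _ _).2
  · rw [← rot_zero, List.mem_map_of_injective rot.injective]
    exact h.1.2
  · rw [List.head?_map]
    intro h13
    obtain ⟨s, hs, hs'⟩ := Option.map_eq_some_iff.1 h13
    rw [← rot_top, rot.injective.eq_iff] at hs'
    exact h.2 (hs' ▸ hs)

theorem cycling_eval {p : ℤ} {x : NC} {L : List NC}
    (h : Normal (x :: L) ∧ (x :: L).head? ≠ some 13) :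
    cycling (eval (p, x :: L)) = eval (p, L ++ [(rot ^ (-p)) x]) := by
  have h1 : val ((rot ^ (-p)) x) * δ ^ p = δ ^ p * val x := by
    rw [val_mul_delta_zpow, ← Equiv.Perm.mul_apply, ← zpow_add, add_neg_cancel, zpow_zero,
      Equiv.Perm.one_apply]
  rw [cycling, if_neg (by rw [len_eval h]; simp), initialFactor_eval h, conj, eval, eval, word_cons,
    word_append, ← mul_assoc (δ ^ p), ← h1]
  simp [word, mul_assoc]

theorem cycling_tau_commute : Function.Commute cycling τ := by
  intro x
  obtain ⟨p, L, h, rfl⟩ := exists_eval x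
  have h' := normal_map_rot h
  rw [tau_eval]
  cases L with
  | nil => rw [cycling, cycling, len_eval h, len_eval h']; simp [tau_eval]
  | cons x L =>
    rw [cycling_eval h, List.map_cons, cycling_eval h', tau_eval, List.map_append, List.map_cons,
      List.map_nil, ← Equiv.Perm.mul_apply, ← Equiv.Perm.mul_apply, ← zpow_one_add, add_comm,
      zpow_add_one]

theorem RigidWord.map_rot {p : ℤ} {L : List NC} (h : RigidWord p L) : RigidWord p (L.map rot) := by
  obtain ⟨x, M, rfl⟩ := List.exists_cons_of_ne_nil h.ne_nil
  refine ⟨by simp, fun y hy => ?_, fun y hy => ?_⟩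
  · obtain ⟨z, hz, rfl⟩ := List.mem_map.1 hy
    have := (zpow_rot_proper (k := 1)).2 (h.proper z hz)
    rwa [zpow_one] at this
  · have hc := h.chain x rfl
    simp only [List.map_cons, List.head?_cons, Option.mem_def, Option.some.injEq] at hy
    have : (x :: M).map rot ++ [(rot ^ (-p)) y] = ((x :: M) ++ [(rot ^ (-p)) x]).map rot := by
      rw [List.map_append, List.map_cons (l := []), ← hy, List.map_nil, ← Equiv.Perm.mul_apply,
        ← Equiv.Perm.mul_apply, ← zpow_one_add, add_comm, zpow_add_one]
    rw [this, List.isChain_map]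
    exact hc.imp fun _ _ => (rot_lw _ _).2

theorem RigidWord.rotate {p : ℤ} {x : NC} {L : List NC} (h : RigidWord p (x :: L)) :
    RigidWord p (L ++ [(rot ^ (-p)) x]) := by
  have hc : (x :: (L ++ [(rot ^ (-p)) x])).IsChain LW := h.chain x rfl
  refine ⟨by simp, fun y hy => ?_, fun y hy => ?_⟩
  · rcases List.mem_append.1 hy with hy | hy
    · exact h.proper y (by simp [hy])
    · rw [List.mem_singleton.1 hy, zpow_rot_proper]
      exact h.proper x (by simp)
  · refine List.isChain_append.2 ⟨hc.tail, by simp, fun a ha b hb => ?_⟩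
    simp only [List.getLast?_append, List.getLast?_singleton, Option.some_or, List.head?_cons,
      Option.mem_def, Option.some.injEq] at ha hb
    rw [← ha, ← hb, zpow_rot_lw]
    exact (List.isChain_cons.1 hc).1 y hy

/-- For a rigid element each cycling merely moves the first letter, rotated, to the end, and the
word stays normal. -/
theorem RigidWord.cycling_iterate {p : ℤ} {K L : List NC} (h : RigidWord p (K ++ L)) :
    cycling^[K.length] (eval (p, K ++ L)) = eval (p, L ++ K.map (rot ^ (-p))) := by
  induction K generalizing L with
  | nil => simp
  | cons x K ih =>
    have h : RigidWord p (x :: (K ++ L)) := h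
    rw [List.length_cons, Function.iterate_succ_apply, List.cons_append, cycling_eval h.isNF,
      List.append_assoc, ih (by rw [← List.append_assoc]; exact h.rotate)]
    simp

/-! ### Rigid elements with factors of both weights -/

/-- The rigid elements with factors of weights `1` and `2`. -/
def Mixed (x : B4) : Prop :=
  ∃ p L, x = eval (p, L) ∧ RigidWord p L ∧ (∃ s ∈ L, rk s = 1) ∧ ∃ s ∈ L, rk s = 2

theorem Mixed.isRigid {x : B4} (h : Mixed x) : IsRigid x := by
  obtain ⟨p, L, rfl, hL, -, -⟩ := h
  exact (rigidWord_iff hL.isNF).1 hL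

theorem Mixed.tau {x : B4} (h : Mixed x) : Mixed (τ x) := by
  obtain ⟨p, L, rfl, hL, ⟨s, hs, hs1⟩, t, ht, ht2⟩ := h
  exact ⟨p, L.map rot, tau_eval p L, hL.map_rot,
    ⟨rot s, List.mem_map_of_mem hs, by rw [rk_rot, hs1]⟩,
    rot t, List.mem_map_of_mem ht, by rw [rk_rot, ht2]⟩

theorem Mixed.cycling {x : B4} (h : Mixed x) : Mixed (cycling x) := by
  obtain ⟨p, L, rfl, hL, h1, h2⟩ := h
  obtain ⟨x, M, rfl⟩ := List.exists_cons_of_ne_nil hL.ne_nil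
  have key : ∀ n, (∃ s ∈ x :: M, rk s = n) → ∃ s ∈ M ++ [(rot ^ (-p)) x], rk s = n := by
    rintro n ⟨s, hs, hn⟩
    rcases List.mem_cons.1 hs with rfl | hs
    · exact ⟨(rot ^ (-p)) s, by simp, by rw [zpow_rot_rk, hn]⟩
    · exact ⟨s, by simp [hs], hn⟩
  exact ⟨p, _, cycling_eval hL.isNF, hL.rotate, key 1 h1, key 2 h2⟩

theorem Mixed.of_mem_orbit {x z : B4} (h : Mixed x) (hz : z ∈ orbit x) : Mixed z := by
  obtain ⟨k, l, rfl⟩ := hz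
  have hc : Mixed (BKL4.cycling^[l] x) := by
    induction l with
    | zero => exact h
    | succ l ih => rw [Function.iterate_succ_apply']; exact ih.cycling
  induction k with
  | zero => exact hc
  | succ k ih => rw [Function.iterate_succ_apply']; exact ih.tau

theorem mem_orbit_trans {x y z : B4} (hy : y ∈ orbit x) (hz : z ∈ orbit y) : z ∈ orbit x := by
  obtain ⟨k, l, rfl⟩ := hy
  obtain ⟨k', l', rfl⟩ := hz
  refine ⟨k' + k, l' + l, ?_⟩
  rw [(cycling_tau_commute.iterate_iterate l' k).eq, ← Function.iterate_add_apply,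
    ← Function.iterate_add_apply]

theorem self_mem_orbit (x : B4) : x ∈ orbit x := ⟨0, 0, rfl⟩

theorem exists_conj_of_mem_orbit {x z : B4} (hz : z ∈ orbit x) : ∃ g, z = conj x g := by
  obtain ⟨k, l, rfl⟩ := hz
  obtain ⟨g, hg⟩ : ∃ g, cycling^[l] x = conj x g := by
    induction l with
    | zero => exact ⟨1, (conj_one x).symm⟩
    | succ l ih =>
      obtain ⟨g, hg⟩ := ih
      rw [Function.iterate_succ_apply', hg, cycling]
      split_ifs
      · exact ⟨g, rfl⟩
      · exact ⟨_, conj_conj _ _ _⟩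
  rw [hg, tau_iterate_eq_conj, conj_conj]
  exact ⟨_, rfl⟩

/-- Conjugating a rigid element with factors of weights `1` and `2` to a rigid element by a simple
element does not leave the orbit. -/
theorem Mixed.conj_val_mem_orbit {x : B4} (h : Mixed x) {t : NC} (ht : IsRigid (conj x (val t))) :
    conj x (val t) ∈ orbit x := by
  have hx := h.isRigid
  have hinf := hx.slidingPeriodic.inf_conj ht.slidingPeriodic
  have hsup := hx.slidingPeriodic.sup_conj ht.slidingPeriodic
  obtain ⟨p, L, rfl, hL, h1, h2⟩ := h
  obtain ⟨q, M, hM, hy⟩ := exists_eval (conj (eval (p, L)) (val t))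
  rw [hy] at hinf hsup ht
  rw [sup, sup, hinf, len_eval hM, len_eval hL.isNF] at hsup
  rw [inf_eval hM, inf_eval hL.isNF] at hinf
  subst hinf
  have hMr := (rigidWord_iff hM).2 ht
  rcases hL.eq_of_conj hMr (by omega) h1 h2 hy with rfl | rfl | ⟨x, hx, rfl⟩ | ⟨z, hz, rfl⟩
  · rw [val_zero, conj_one]
    exact self_mem_orbit _
  · exact ⟨1, 0, rfl⟩
  · obtain ⟨N, rfl⟩ := List.head?_eq_some_iff.1 hx
    refine ⟨0, 1, ?_⟩
    change _ = BKL4.cycling _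
    rw [BKL4.cycling, if_neg (by rw [len_eval hL.isNF]; simp), initialFactor_eval hL.isNF]
  · obtain ⟨N, rfl⟩ := List.getLast?_eq_some_iff.1 hz
    obtain ⟨k, hk⟩ := exists_eval_map_zpow_rot q
    -- Conjugating by ∂(z) = z⁻¹ δ undoes one cycling and applies τ. Cycling all letters but the
    -- last reaches the same element up to rotation, which τ^k corrects.
    refine ⟨k + 1, N.length, ?_⟩
    rw [hL.cycling_iterate, Nat.add_comm, Function.iterate_add_apply, ← hk]
    have h3 : ([z] ++ N.map (rot ^ (-q))).map (rot ^ q) = (rot ^ q) z :: N := by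
      rw [List.map_append, List.map_map, ← Equiv.Perm.coe_mul, ← zpow_add, add_neg_cancel]
      simp
    have h4 : val z * δ ^ q = δ ^ q * val ((rot ^ q) z) := val_mul_delta_zpow z q
    rw [h3, val_comp, compl, ← conj_conj]
    change τ _ = τ _
    rw [conj, inv_inv, eval, eval, word_append, word_cons, word_nil, mul_one, word_cons,
      ← mul_assoc (δ ^ q) (val _), ← h4]
    simp [mul_assoc]

theorem inf_delta_ne_one {g : B4} (h : 1 ≤ g) (hg : g ≠ 1) : g ⊓ δ ≠ 1 := by
  obtain ⟨L, rfl⟩ := exists_word_of_mem_positive (one_le_iff.1 h)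
  clear h
  induction L with
  | nil => exact absurd rfl hg
  | cons x L ih =>
    by_cases hx : x = 0
    · rw [hx, word_cons, val_zero, one_mul] at hg ⊢
      exact ih hg
    · intro h1
      refine hx (val_injective ?_)
      rw [val_zero]
      refine le_antisymm ?_ (one_le_val x)
      rw [← h1, word_cons]
      exact le_inf (le_mul_of_one_le_right' (one_le_word L)) (val_le_delta x)

/-- Induction on the weight of g, splitting off the simple prefix g ∧ δ; the intermediate element is
rigid and again has factors of both weights. -/
theorem Mixed.conj_mem_orbit_of_one_le {x g : B4} (h : Mixed x) (hg1 : 1 ≤ g)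
    (hg : IsRigid (conj x g)) : conj x g ∈ orbit x := by
  obtain ⟨n, hn⟩ : ∃ n : ℕ, weight g ≤ n := ⟨(weight g).toNat, by omega⟩
  induction n generalizing x g with
  | zero =>
    have h1 : 1 = g := eq_of_le_of_weight_le hg1 (by rw [weight_one]; exact_mod_cast hn)
    rw [← h1, conj_one]
    exact self_mem_orbit x
  | succ n ih =>
    by_cases h1 : g = 1
    · rw [h1, conj_one]
      exact self_mem_orbit x
    · obtain ⟨t, ht⟩ := exists_val_of_le_delta (le_inf hg1 one_le_delta) inf_le_right
      have hs : conj x (val t) ∈ orbit x :=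
        h.conj_val_mem_orbit (by rw [ht]; exact h.isRigid.isRigid_conj_inf_delta hg)
      have hlt : 1 < val t := lt_of_le_of_ne (one_le_val t)
        (by rw [ht]; exact (inf_delta_ne_one hg1 h1).symm)
      have hw := weight_lt_of_lt hlt
      have hmul : val t * ((val t)⁻¹ * g) = g := by simp
      have hwg := weight_mul (val t) ((val t)⁻¹ * g)
      rw [hmul] at hwg
      rw [weight_one] at hw
      have key := ih (x := conj x (val t)) (g := (val t)⁻¹ * g) (h.of_mem_orbit hs)
        (by rw [le_inv_mul_iff_mul_le, mul_one, ht]; exact inf_le_left)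
        (by rwa [conj_conj, hmul]) (by push_cast at hn; omega)
      rw [conj_conj, hmul] at key
      exact mem_orbit_trans hs key

theorem Mixed.conj_mem_orbit {x g : B4} (h : Mixed x) (hg : IsRigid (conj x g)) :
    conj x g ∈ orbit x := by
  obtain ⟨m, hm, -⟩ := exists_delta_bounds g
  -- Since δ ^ 4 is central, g may be made positive without changing the conjugate.
  have h4 : conj x (δ ^ ((4 * m : ℕ) : ℤ) * g) = conj x g := by
    rw [← conj_conj, ← tau_iterate_eq_conj, tau_iterate_mod, Nat.mul_mod_right,
      Function.iterate_zero, id]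
  rw [← h4] at hg ⊢
  refine h.conj_mem_orbit_of_one_le ?_ hg
  have h5 := mul_le_mul_right ((delta_zpow_le (a := -(4 * m : ℕ)) (b := -m) (by omega)).trans hm)
    (δ ^ ((4 * m : ℕ) : ℤ))
  rwa [← zpow_add, add_neg_cancel, zpow_zero] at h5

theorem Mixed.SC_eq_orbit {x : B4} (h : Mixed x) : SC x = orbit x := by
  ext z
  constructor
  · rintro ⟨⟨g, rfl⟩, hz⟩
    exact h.conj_mem_orbit (h.isRigid.isRigid_conj hz)
  · intro hz
    exact ⟨exists_conj_of_mem_orbit hz, (h.of_mem_orbit hz).isRigid.slidingPeriodic⟩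

theorem Mixed.orbit_subset {x : B4} (h : Mixed x) :
    orbit x ⊆ (fun n : ℕ × ℕ => τ^[n.1] (BKL4.cycling^[n.2] x)) ''
      (Finset.range 4 ×ˢ Finset.range (len x) : Finset (ℕ × ℕ)) := by
  obtain ⟨p, L, rfl, hL, -, -⟩ := h
  rw [len_eval hL.isNF]
  have hpos : 0 < L.length := List.length_pos_iff.2 hL.ne_nil
  obtain ⟨j, hj⟩ := exists_eval_map_zpow_rot (-p)
  -- A full round of cyclings rotates every letter by the same amount, so cycling exponents reduce
  -- modulo the length at the cost of a power of τ.
  have hr : BKL4.cycling^[L.length] (eval (p, L)) = τ^[j] (eval (p, L)) := by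
    have h := hL
    rw [← List.append_nil L] at h
    have := h.cycling_iterate
    rwa [List.append_nil, List.nil_append, hj] at this
  have hrm : ∀ m, BKL4.cycling^[L.length * m] (eval (p, L)) = τ^[j * m] (eval (p, L)) := by
    intro m
    induction m with
    | zero => rfl
    | succ m ih =>
      rw [Nat.mul_succ, add_comm, Function.iterate_add_apply, ih,
        (cycling_tau_commute.iterate_iterate _ _).eq, hr, ← Function.iterate_add_apply,
        Nat.mul_succ]
  rintro z ⟨k, l, rfl⟩
  refine ⟨((k + j * (l / L.length)) % 4, l % L.length), ?_, ?_⟩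
  · simp only [Finset.coe_product, Set.mem_prod, Finset.coe_range, Set.mem_Iio]
    exact ⟨Nat.mod_lt _ (by norm_num), Nat.mod_lt _ hpos⟩
  · simp only
    rw [← tau_iterate_mod, Function.iterate_add_apply,
      ← (cycling_tau_commute.iterate_iterate _ _).eq, ← hrm, ← Function.iterate_add_apply,
      Nat.mod_add_div]

theorem Mixed.orbit_finite {x : B4} (h : Mixed x) : (orbit x).Finite :=
  ((Finset.finite_toSet _).image _).subset h.orbit_subset

theorem Mixed.ncard_orbit_le {x : B4} (h : Mixed x) : (orbit x).ncard ≤ 4 * len x := by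
  refine (Set.ncard_le_ncard h.orbit_subset ((Finset.finite_toSet _).image _)).trans ?_
  refine (Set.ncard_image_le (Finset.finite_toSet _)).trans ?_
  rw [Set.ncard_coe_finset]
  simp

theorem IsRigid.mixed {x : B4} (hx : IsRigid x) (h1 : ∃ s ∈ factors x, weight s = 1)
    (h2 : ∃ s ∈ factors x, weight s = 2) : Mixed x := by
  obtain ⟨p, L, hL, rfl⟩ := exists_eval x
  rw [factors_eval hL] at h1 h2
  simp only [List.mem_map, exists_exists_and_eq_and, weight_val] at h1 h2
  exact ⟨p, L, rfl, (rigidWord_iff hL).2 hx, by exact_mod_cast h1, by exact_mod_cast h2⟩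

end BKL4

theorem proposition3p1 (x : BKL4.B4) (hx : BKL4.IsRigid x)
    (h1 : ∃ s ∈ BKL4.factors x, BKL4.weight s = 1)
    (h2 : ∃ s ∈ BKL4.factors x, BKL4.weight s = 2) :
    BKL4.SC x = BKL4.orbit x ∧
      (BKL4.SC x).Finite ∧ (BKL4.SC x).ncard ≤ 4 * BKL4.len x := by
  have h := hx.mixed h1 h2
  rw [h.SC_eq_orbit]
  exact ⟨rfl, h.orbit_finite, h.ncard_orbit_le⟩
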